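/- Let $d\ge 1$. For $f\in L^1(\mathbb R^d)$ put $\hat f(k)=(2\pi)^{-d/2}\int_{\mathbb R^d}e^{-i\langle x,k\rangle}f(x)\,dx$, and for an integrable $b\ge 0$ with $b^{(0)}=\int b(x)\,dx$ let the one-particle jump process with kernel $b$ be the continuous-time Markov jump process on $\mathbb R^d$ with bounded generator $A f(x)=\int_{\mathbb R^d} b(x-y)\,(f(y)-f(x))\,dy$, i.e. $X_t=Y_{Z_t}$, where $Y$ is the Markov chain with transition density $b(x-y)/b^{(0)}$ from $x$ to $y$ and $Z$ is an independent Poisson process with parameter $b^{(0)}$. The free Kawasaki dynamics $(\mathbf X_t)_{t\ge 0}$ with kernel $b$ started at a locally finite configuration $\gamma\subset\mathbb R^d$ consists of independent copies of this process, one started at each point of $\gamma$; $\mathbf E_\gamma$ denotes the corresponding expectation. For a bounded measurable $\zeta\ge0$ let $\pi_\zeta$ be the Poisson measure with intensity $\zeta(x)\,dx$ on the space $\Gamma$ of locally finite configurations. Let $0\le a\in L^1(\mathbb R^d)$, let $p(x)=\tfrac12(a(x)+a(-x))$ and $q(x)=\tfrac12(a(x)-a(-x))$ be its even and odd parts, and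 let $a_\varepsilon=p+\varepsilon q$ (which is non-negative for $0<\varepsilon\le 1$). Assume that $p^{(2)}_{ij}=\int x_ix_j\,p(x)\,dx$ is finite (absolutely convergent) for all $i,j=1,\dots,d$, and that $q^{(1)}=\int x\,q(x)\,dx\neq 0$. Put $a^{(1)}=\int x\,a(x)\,dx$ (which equals $q^{(1)}$) and $a^{(2)}_{ij}=\int x_ix_j\,a(x)\,dx$. Let $z\ge 0$ be a bounded measurable function on $\mathbb R^d$ whose Fourier transform, in the sense of tempered distributions, is a signed measure $\hat z$ (possibly complex-valued and of infinite total variation, but such that all Schwartz functions are integrable with respect to its total variation). For $\varphi\in C_c^\infty(\mathbb R^d)$ real-valued, $t\ge 0$ and $0<\varepsilon\le 1$ let $$n^{(\varepsilon)}_t(\varphi,\mathbf X)=\sum_{x\in \mathbf X_{\varepsilon^{-2}t}}\varepsilon^d\varphi(\varepsilon x)$$ be the scaled empirical field (with $\kappa=2$) of the free Kawasaki dynamics with kernel $a_\varepsilon$. Then for every $t\ge 0$ and every $\varphi\in C_c^\infty(\mathbb R^d)$ the Laplace transform $\int_\Gamma\pi_{z(\varepsilon\cdot)}(d\gamma)\,\mathbf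 E_\gamma\big[e^{n^{(\varepsilon)}_t(\varphi,\mathbf X)}\big]$ is finite for all sufficiently small $\varepsilon>0$, and $$\lim_{\varepsilon\to0^+}\int_\Gamma\pi_{z(\varepsilon\cdot)}(d\gamma)\,\mathbf E_\gamma\big[e^{n^{(\varepsilon)}_t(\varphi,\mathbf X)}\big]=\exp\left(\frac1{(2\pi)^{d/2}}\int_{\mathbb R^d}dx\,z(x)\int_{\mathbb R^d}dk\,e^{i\langle k,x\rangle}\,e^{-it\langle a^{(1)},k\rangle-\frac t2\langle a^{(2)}k,k\rangle}\,\hat\varphi(k)\right).$$ -/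

import Mathlib

open MeasureTheory ProbabilityTheory Filter Topology
open scoped SchwartzMap ENNReal NNReal

noncomputable section

namespace FreeKawasaki

/-- The space `ℝ^d` with its Euclidean norm, inner product and Lebesgue measure. -/
abbrev Space (d : ℕ) : Type := EuclideanSpace ℝ (Fin d)

/-! ### Configurations -/

/-- The configuration space `Γ` of all locally finite subsets of `ℝ^d`. -/
def Config (d : ℕ) : Type :=
  {γ : Set (Space d) // ∀ K : Set (Space d), IsCompact K → (γ ∩ K).Finite}

/-- The pairing `⟨f, γ⟩ = ∑_{x ∈ γ} f x` (a finite sum when `f` has compact support). -/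
def pairing {d : ℕ} (f : Space d → ℝ) (γ : Config d) : ℝ := ∑' x : γ.1, f x

/-- The σ-algebra on `Γ` generated by the maps `γ ↦ ⟨f, γ⟩`, `f ∈ C_c(ℝ^d)`; it is the Borel
σ-algebra of the vague topology. -/
instance (d : ℕ) : MeasurableSpace (Config d) :=
  ⨆ (f : Space d → ℝ) (_ : Continuous f ∧ HasCompactSupport f),
    MeasurableSpace.comap (pairing f) (borel ℝ)

/-! ### Poisson measures -/

open Classical in
/-- The probability measure proportional to a finite nonzero measure `μ` (and, by convention, the
Dirac measure at the default point when `μ` is zero or infinite). -/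
def normalized {α : Type*} [MeasurableSpace α] [Inhabited α] (μ : Measure α) : Measure α :=
  if μ Set.univ ≠ 0 ∧ μ Set.univ ≠ ∞ then (μ Set.univ)⁻¹ • μ else Measure.dirac default

/-- The measure `z(x) dx`. -/
def intensityMeasure {d : ℕ} (z : Space d → ℝ) : Measure (Space d) :=
  volume.withDensity fun x => ENNReal.ofReal (z x)

/-- The spherical shell `{x : n ≤ |x| < n + 1}`; these shells partition `ℝ^d`. -/
def shell (d n : ℕ) : Set (Space d) := {x | (n : ℝ) ≤ ‖x‖ ∧ ‖x‖ < n + 1}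

/-- The configuration which, in the `n`-th shell, consists of the first `N_n` points of a
sequence `U_{n,0}, U_{n,1}, …`, where `(N_n, U_n) = w n` (points outside the shell are
discarded). -/
def scatter {d : ℕ} (w : ℕ → ℕ × (ℕ → Space d)) : Config d :=
  ⟨{x | ∃ n i : ℕ, i < (w n).1 ∧ (w n).2 i = x ∧ x ∈ shell d n}, by
    intro K hK
    obtain ⟨R, hR⟩ := hK.isBounded.exists_norm_le
    have hfin : (⋃ n ∈ Set.Iic ⌊R⌋₊, (fun i => (w n).2 i) '' Set.Iio (w n).1).Finite :=
      (Set.finite_Iic _).biUnion fun n _ => (Set.finite_Iio _).image _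
    refine hfin.subset ?_
    rintro x ⟨⟨n, i, hi, rfl, hx⟩, hxK⟩
    have hn : n ≤ ⌊R⌋₊ := Nat.le_floor (hx.1.trans (hR _ hxK))
    exact Set.mem_biUnion (show n ∈ Set.Iic ⌊R⌋₊ from hn) ⟨i, hi, rfl⟩⟩

/-- The Poisson measure `π_z` on `Γ` with intensity `z(x) dx`: independently in each shell `S`,
the number of points is Poisson distributed with parameter `∫_S z` and, given their number, the
points are independent with distribution `z(x) dx / ∫_S z` on `S`. -/
def poissonConfig {d : ℕ} (z : Space d → ℝ) : Measure (Config d) :=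
  (Measure.infinitePi fun n : ℕ =>
    (poissonMeasure (intensityMeasure z (shell d n)).toNNReal).prod
      (Measure.infinitePi fun _ : ℕ =>
        normalized ((intensityMeasure z).restrict (shell d n)))).map scatter

/-! ### The one particle jump process -/

/-- The total jump rate `b^{(0)} = ∫ b(x) dx`. -/
def totalRate {d : ℕ} (b : Space d → ℝ) : ℝ := ∫ x, b x

/-- The distribution with density `b / b^{(0)}`. -/
def jumpLaw {d : ℕ} (b : Space d → ℝ) : Measure (Space d) := normalized (intensityMeasure b)

/-- The law of the randomness driving one particle: an i.i.d. sequence of pairs consisting of a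
standard exponential variable and an independent variable with density `b / b^{(0)}`. -/
def particleLaw {d : ℕ} (b : Space d → ℝ) : Measure (ℕ → ℝ × Space d) :=
  Measure.infinitePi fun _ : ℕ => (expMeasure 1).prod (jumpLaw b)

/-- The Poisson process `Z_t` with parameter `r`: the `(n+1)`-st jump occurs at the time `t` with
`r t = τ_0 + ⋯ + τ_n`, where the `τ_i` are independent standard exponential variables. -/
def jumpCount {d : ℕ} (r t : ℝ) (w : ℕ → ℝ × Space d) : ℕ :=
  Set.ncard {n : ℕ | ∑ i ∈ Finset.range (n + 1), (w i).1 ≤ r * t}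

/-- The Markov chain `Y_k` started at `x` with transition density `b (x - y) / b^{(0)}` from `x`
to `y`. -/
def chain {d : ℕ} (x : Space d) (w : ℕ → ℝ × Space d) (k : ℕ) : Space d :=
  x - ∑ i ∈ Finset.range k, (w i).2

/-- The jump process `X_t = Y_{Z_t}` started at `x`, with rate `b (x - y)` for jumps from `x`
to `y`. -/
def jumpProcess {d : ℕ} (b : Space d → ℝ) (x : Space d) (t : ℝ) (w : ℕ → ℝ × Space d) :
    Space d :=
  chain x w (jumpCount (totalRate b) t w)

/-! ### The free Kawasaki dynamics -/

/-- The law `P_γ` of the randomness driving the particle system started at `γ`: independent copies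
of the randomness of one particle, one for each point of `γ`. -/
def kawasakiLaw {d : ℕ} (b : Space d → ℝ) (γ : Config d) : Measure (γ.1 → ℕ → ℝ × Space d) :=
  Measure.infinitePi fun _ : γ.1 => particleLaw b

/-- The free Kawasaki dynamics `𝐗_t` with jump rate `b` started at `γ`: the family of the positions
at time `t` of the particles started at the points of `γ`, which move as independent jump
processes. -/
def kawasaki {d : ℕ} (b : Space d → ℝ) (γ : Config d) (t : ℝ)
    (ω : γ.1 → ℕ → ℝ × Space d) : γ.1 → Space d :=
  fun x => jumpProcess b x.1 t (ω x)

/-- The empirical field `n_t(φ, 𝐗) = ⟨φ, 𝐗_t⟩`. -/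
def empiricalField {d : ℕ} (b : Space d → ℝ) (γ : Config d) (t : ℝ) (φ : Space d → ℝ)
    (ω : γ.1 → ℕ → ℝ × Space d) : ℝ :=
  ∑' x : γ.1, φ (kawasaki b γ t ω x)

/-- The scaled empirical field
`n_t^{(ε)}(φ, 𝐗) = n_{ε^{-κ} t}(ε^d φ(ε ·), 𝐗)`. -/
def scaledField {d : ℕ} (κ : ℕ) (b : Space d → ℝ) (γ : Config d) (ε t : ℝ) (φ : Space d → ℝ)
    (ω : γ.1 → ℕ → ℝ × Space d) : ℝ :=
  empiricalField b γ ((ε ^ κ)⁻¹ * t) (fun x => ε ^ d * φ (ε • x)) ω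

/-- The Laplace transform `∫ π_{z(ε ·)}(dγ) E_γ [exp (n_t^{(ε)}(φ, 𝐗))] ∈ [0, ∞]` of the scaled
empirical field, for the dynamics with jump rate `b`. -/
def scaledLaplace {d : ℕ} (κ : ℕ) (b z : Space d → ℝ) (ε t : ℝ) (φ : Space d → ℝ) : ℝ≥0∞ :=
  ∫⁻ γ, ∫⁻ ω, ENNReal.ofReal (Real.exp (scaledField κ b γ ε t φ ω)) ∂(kawasakiLaw b γ)
    ∂(poissonConfig fun x => z (ε • x))

/-! ### Even and odd parts, moments -/

/-- The even part `p` of `a`. -/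
def evenPart {d : ℕ} (a : Space d → ℝ) (x : Space d) : ℝ := (a x + a (-x)) / 2

/-- The odd part `q` of `a`. -/
def oddPart {d : ℕ} (a : Space d → ℝ) (x : Space d) : ℝ := (a x - a (-x)) / 2

/-- The weakly asymmetric kernel `a_ε = p + ε q`. -/
def weakKernel {d : ℕ} (a : Space d → ℝ) (ε : ℝ) (x : Space d) : ℝ :=
  evenPart a x + ε * oddPart a x

/-- The vector of first moments `f^{(1)} = ∫ x f(x) dx`. -/
def firstMoment {d : ℕ} (f : Space d → ℝ) : Space d := ∫ x, f x • x

/-- The second moments `f^{(2)}_{ij} = ∫ x_i x_j f(x) dx`. -/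
def secondMoment {d : ℕ} (f : Space d → ℝ) (i j : Fin d) : ℝ := ∫ x, x i * x j * f x

/-! ### Fourier transform -/

/-- The Fourier transform `f̂(k) = (2π)^{-d/2} ∫ e^{-i⟨x,k⟩} f(x) dx`. -/
def fourier {d : ℕ} (f : Space d → ℂ) (k : Space d) : ℂ :=
  (((2 * Real.pi) ^ (-(d : ℝ) / 2) : ℝ) : ℂ) *
    ∫ x, Complex.exp (-(Complex.I * ((inner ℝ x k : ℝ) : ℂ))) * f x

/-- The Fourier transform of `z`, as a tempered distribution, is a signed measure
`ẑ(dk) = h(k) ν(dk)`; here `ν` is the total variation of `ẑ`, against which all Schwartz functions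
are integrable, and `h` is its (in general complex) phase. The total mass of `ν` may be
infinite. -/
def FourierIsSignedMeasure {d : ℕ} (z : Space d → ℝ) : Prop :=
  ∃ (ν : Measure (Space d)) (h : Space d → ℂ),
    ν.HasTemperateGrowth ∧ Measurable h ∧ (∀ k, ‖h k‖ = 1) ∧
    ∀ ψ : 𝓢(Space d, ℂ), ∫ x, (z x : ℂ) * fourier ψ x = ∫ k, ψ k * h k ∂ν

/-- The function
`x ↦ (2π)^{-d/2} ∫ e^{i⟨k,x⟩} exp (-i t ⟨v,k⟩ - (t/2) ⟨σ k,k⟩) φ̂(k) dk`. -/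
def driftDiffusion {d : ℕ} (v : Space d) (σ : Fin d → Fin d → ℝ) (t : ℝ) (φ : Space d → ℝ)
    (x : Space d) : ℂ :=
  (((2 * Real.pi) ^ (-(d : ℝ) / 2) : ℝ) : ℂ) *
    ∫ k, Complex.exp (Complex.I * ((inner ℝ k x : ℝ) : ℂ)) *
      Complex.exp (-(Complex.I * (t : ℂ) * ((inner ℝ v k : ℝ) : ℂ))
        - (t : ℂ) / 2 * ((∑ i, ∑ j, σ i j * k j * k i : ℝ) : ℂ)) *
      fourier (fun y => (φ y : ℂ)) k

end FreeKawasaki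

end

namespace FreeKawasaki

/-! ### Exponential waiting times -/

/-! Independence and the Poisson structure make the Laplace transform explicit, after which only a
central limit theorem for one particle is left.

A particle started at `x` is at `x - D`, where `D` is compound Poisson: the exponential waiting
times give a Poisson number of jumps, independent of the jump sizes, so `D` has characteristic
function `exp (t ∫ b(u) (e^{i⟨u,k⟩} - 1) du)` (`charFun_displacementLaw`). For a fixed configuration
the exponential moment of the field is a product over particles, that is, the exponential of a
pairing with a logarithm. The Laplace functional of the Poisson measure
(`lintegral_exp_pairing_poissonConfig`) then yields `exp (∫ z(x) (E e^{ψ(x - D)} - 1) dx)`. Since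
particles can arrive from arbitrarily far away, these identities are first proved with weights that
switch off distant starting points; `lintegral_exp_field` removes the weights by dominated
convergence.

The substitution `y = εx` absorbs the factor `ε^{-d}` into `ε^{-d} (e^{ε^d φ} - 1)`, which tends to
`φ` in `L¹`. By Fubini the exponent is the mean of a bounded continuous function of the rescaled
displacement `εD` (`exponent_eq_integral_smear`). In the characteristic exponent the even part of
the kernel multiplies `cos - 1` and the odd part `ε sin`; at frequency `εk` both are of order `ε²`,
which the time scale `ε^{-2}` compensates (`tendsto_charExponent`). Lévy's continuity theorem gives
weak convergence of `εD` to a Gaussian with mean `t a^{(1)}` and covariance `t a^{(2)}`. Finally,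
Fourier inversion writes the average of `φ` over this Gaussian as the Fourier integral of the
statement (`driftDiffusion_eq_integral`). -/

instance isProbabilityMeasure_expMeasure_one : IsProbabilityMeasure (expMeasure 1) :=
  isProbabilityMeasure_expMeasure one_pos

/-- The Poisson weights `e^{-s} s^n / n!`, extended by zero to negative `s`. -/
noncomputable def poissonWeight (n : ℕ) (s : ℝ) : ℝ≥0∞ :=
  if 0 ≤ s then ENNReal.ofReal (Real.exp (-s) * s ^ n / n.factorial) else 0

lemma measurable_poissonWeight (n : ℕ) : Measurable (poissonWeight n) :=
  Measurable.ite measurableSet_Ici (by fun_prop) measurable_const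

lemma lintegral_expMeasure_one (f : ℝ → ℝ≥0∞) (hf : Measurable f) :
    ∫⁻ x, f x ∂expMeasure 1
      = ∫⁻ x, (if 0 ≤ x then ENNReal.ofReal (Real.exp (-x)) else 0) * f x := by
  have h : expMeasure 1 = volume.withDensity (exponentialPDF 1) := rfl
  have hm : Measurable (exponentialPDF 1) := (measurable_exponentialPDFReal 1).ennreal_ofReal
  rw [h, lintegral_withDensity_eq_lintegral_mul _ hm hf]
  refine lintegral_congr fun x => ?_
  simp only [Pi.mul_apply, exponentialPDF_eq]
  split_ifs <;> simp

/-- One more exponential waiting time raises the Poisson index by one: the exponentials combine to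
`e^{-s}`, and `∫_0^s (s - x)^m dx = s^{m+1}/(m+1)`. Extending the weights by zero cuts the integral
off at `s`. -/
lemma lintegral_poissonWeight_sub (m : ℕ) (s : ℝ) :
    ∫⁻ x, poissonWeight m (s - x) ∂expMeasure 1 = poissonWeight (m + 1) s := by
  have hm := measurable_poissonWeight m
  rw [lintegral_expMeasure_one (fun x => poissonWeight m (s - x)) (by fun_prop)]
  have h1 : ∀ x : ℝ, (if 0 ≤ x then ENNReal.ofReal (Real.exp (-x)) else 0) *
      poissonWeight m (s - x) = (Set.Icc 0 s).indicator
        (fun x => ENNReal.ofReal (Real.exp (-s) * (s - x) ^ m / m.factorial)) x := by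
    intro x
    unfold poissonWeight
    by_cases hx : 0 ≤ x
    · by_cases hs : 0 ≤ s - x
      · rw [if_pos hx, if_pos hs, Set.indicator_of_mem (show x ∈ Set.Icc 0 s from ⟨hx, by linarith⟩),
          ← ENNReal.ofReal_mul (Real.exp_nonneg _)]
        congr 1
        have : Real.exp (-s) = Real.exp (-x) * Real.exp (-(s - x)) := by
          rw [← Real.exp_add]; congr 1; ring
        rw [this]; ring
      · rw [if_neg hs, mul_zero, Set.indicator_of_notMem]
        exact fun h => hs (by linarith [h.2])
    · rw [if_neg hx, zero_mul, Set.indicator_of_notMem]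
      exact fun h => hx h.1
  simp_rw [h1]
  rw [lintegral_indicator measurableSet_Icc]
  unfold poissonWeight
  split_ifs with hs
  · rw [← ofReal_integral_eq_lintegral_ofReal]
    · congr 1
      rw [integral_Icc_eq_integral_Ioc, ← intervalIntegral.integral_of_le hs]
      have : ∀ x : ℝ, Real.exp (-s) * (s - x) ^ m / m.factorial
          = (Real.exp (-s) / m.factorial) * (s - x) ^ m := fun x => by ring
      simp_rw [this]
      rw [intervalIntegral.integral_const_mul,
        intervalIntegral.integral_comp_sub_left (fun x => x ^ m), integral_pow]
      simp only [sub_self, sub_zero, Nat.factorial_succ, Nat.cast_mul, Nat.cast_add, Nat.cast_one]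
      field_simp
      simp
    · exact Continuous.integrableOn_Icc (by fun_prop)
    · filter_upwards [ae_restrict_mem measurableSet_Icc] with x hx
      have : 0 ≤ s - x := by linarith [hx.2]
      positivity
  · rw [Set.Icc_eq_empty hs]; simp

lemma expMeasure_one_Ioi (u : ℝ) (hu : 0 ≤ u) :
    expMeasure 1 (Set.Ioi u) = ENNReal.ofReal (Real.exp (-u)) := by
  rw [← Set.compl_Iic, prob_compl_eq_one_sub measurableSet_Iic, ← ofReal_cdf,
    cdf_expMeasure_eq one_pos, if_pos hu, ← ENNReal.ofReal_one,
    ← ENNReal.ofReal_sub _ (by simp [hu])]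
  simp

lemma lintegral_expMeasure_waiting (T s : ℝ) :
    ∫⁻ x, (if T ≤ s ∧ s < T + x then 1 else 0 : ℝ≥0∞) ∂expMeasure 1 = poissonWeight 0 (s - T) := by
  unfold poissonWeight
  by_cases h : T ≤ s
  · rw [if_pos (by linarith), pow_zero, mul_one, Nat.factorial_zero, Nat.cast_one, div_one,
      ← expMeasure_one_Ioi _ (by linarith), ← lintegral_indicator_one measurableSet_Ioi]
    refine lintegral_congr fun x => ?_
    simp only [Set.indicator_apply, Set.mem_Ioi, Pi.one_apply, h, true_and]
    congr 1
    exact propext (by constructor <;> intro _ <;> linarith)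
  · rw [if_neg (by linarith)]
    simp [h]

lemma ae_pos_expMeasure_one : ∀ᵐ x ∂expMeasure 1, 0 < x := by
  have h := expMeasure_one_Ioi 0 le_rfl
  rw [neg_zero, Real.exp_zero, ENNReal.ofReal_one] at h
  exact (prob_compl_eq_zero_iff measurableSet_Ioi).2 h

lemma measurableSet_le_lt_add {α : Type*} [MeasurableSpace α] {f g : α → ℝ} (hf : Measurable f)
    (hg : Measurable g) (s : ℝ) : MeasurableSet {y | f y ≤ s ∧ s < f y + g y} :=
  ((measurableSet_le hf measurable_const).inter
    (measurableSet_lt measurable_const (hf.add hg))).congr (Set.ext fun _ => Iff.rfl)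

/-! ### The marked renewal process -/

section Renewal

variable {d : ℕ} (ρ : Measure (Space d)) [IsProbabilityMeasure ρ]

/-- Independent standard exponential waiting times with independent marks of law `ρ`. -/
noncomputable def markedLaw (ρ : Measure (Space d)) : Measure (ℕ → ℝ × Space d) :=
  Measure.infinitePi fun _ : ℕ => (expMeasure 1).prod ρ

instance : IsProbabilityMeasure (markedLaw ρ) := by
  unfold markedLaw; infer_instance

/-- The partial sums of the first `n` waiting times and marks. -/
noncomputable def partialSum (n : ℕ) (w : ℕ → ℝ × Space d) : ℝ × Space d :=
  ∑ i ∈ Finset.range n, w i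

lemma measurable_partialSum (n : ℕ) : Measurable (partialSum (d := d) n) := by
  unfold partialSum; fun_prop

/-- The first `n` pairs are independent of the next one, whose two components are independent of
each other. The iterated form allows the waiting time to be integrated out with everything else
fixed. -/
lemma lintegral_partialSum_and_next (n : ℕ) (f : (ℝ × Space d) × (ℝ × Space d) → ℝ≥0∞)
    (hf : Measurable f) :
    ∫⁻ w, f (partialSum n w, w n) ∂markedLaw ρ
      = ∫⁻ v, ∫⁻ x, ∫⁻ w, f (partialSum n w, (x, v)) ∂markedLaw ρ ∂expMeasure 1 ∂ρ := by
  have hI : iIndepFun (fun (i : ℕ) (w : ℕ → ℝ × Space d) => w i) (markedLaw ρ) :=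
    iIndepFun_infinitePi (X := fun _ x => x) (by fun_prop)
  have h2 : IndepFun (partialSum n) (fun w : ℕ → ℝ × Space d => w n) (markedLaw ρ) := by
    have := hI.indepFun_finsetSum_of_notMem (fun i => measurable_pi_apply i)
      (s := Finset.range n) (i := n) (by simp)
    convert this using 1
    ext1 w; simp [partialSum]
  have h3 := (indepFun_iff_map_prod_eq_prod_map_map (measurable_partialSum n).aemeasurable
    (measurable_pi_apply n).aemeasurable).1 h2
  have h4 : (markedLaw ρ).map (fun w : ℕ → ℝ × Space d => w n) = (expMeasure 1).prod ρ :=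
    Measure.infinitePi_map_eval _ n
  have : IsProbabilityMeasure ((markedLaw ρ).map (partialSum n)) :=
    Measure.isProbabilityMeasure_map (measurable_partialSum n).aemeasurable
  rw [← lintegral_map (μ := markedLaw ρ) hf (by have := measurable_partialSum (d := d) n; fun_prop),
    h3, h4, lintegral_prod_symm' _ hf, lintegral_prod_symm']
  · refine lintegral_congr fun v => lintegral_congr fun x => ?_
    rw [lintegral_map (by fun_prop) (measurable_partialSum n)]
  · exact hf.lintegral_prod_left'

/-- Each waiting time raises the index by one and leaves the marks alone, so the weight factors out.
The index `m` and the function `h` must stay general: the induction step calls the hypothesis at `m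
+ 1` with a translate of `h`. -/
lemma lintegral_poissonWeight_partialSum (n : ℕ) : ∀ (m : ℕ) (s : ℝ) (h : Space d → ℝ≥0∞),
    Measurable h →
    ∫⁻ w, poissonWeight m (s - (partialSum n w).1) * h (partialSum n w).2 ∂markedLaw ρ
      = poissonWeight (m + n) s * ∫⁻ w, h (partialSum n w).2 ∂markedLaw ρ := by
  induction n with
  | zero => intro m s h hh; simp [partialSum]
  | succ n ih =>
    intro m s h hh
    have hm := measurable_poissonWeight
    have hp := measurable_partialSum (d := d)
    have hsucc : ∀ w : ℕ → ℝ × Space d, partialSum (n + 1) w = partialSum n w + w n :=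
      fun w => Finset.sum_range_succ _ _
    have e1 := lintegral_partialSum_and_next ρ n
      (fun y => poissonWeight m (s - (y.1 + y.2).1) * h (y.1 + y.2).2) (by fun_prop)
    have e2 := lintegral_partialSum_and_next ρ n (fun y => h (y.1 + y.2).2) (by fun_prop)
    simp only [Prod.fst_add, Prod.snd_add] at e1 e2
    simp only [hsucc, Prod.fst_add, Prod.snd_add]
    rw [e1, e2]
    simp only [lintegral_const, measure_univ, mul_one]
    rw [← lintegral_const_mul _ (Measurable.lintegral_prod_right' (f := fun y : Space d × _ =>
      h ((partialSum n y.2).2 + y.1)) (by fun_prop))]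
    refine lintegral_congr fun v => ?_
    rw [lintegral_lintegral_swap (by fun_prop)]
    have : ∀ w : ℕ → ℝ × Space d,
        ∫⁻ x, poissonWeight m (s - ((partialSum n w).1 + x)) * h ((partialSum n w).2 + v)
          ∂expMeasure 1
        = poissonWeight (m + 1) (s - (partialSum n w).1) * h ((partialSum n w).2 + v) := by
      intro w
      rw [lintegral_mul_const _ (by fun_prop), ← lintegral_poissonWeight_sub]
      simp only [sub_sub]
    simp_rw [this]
    rw [ih (m + 1) s (fun y => h (y + v)) (by fun_prop)]
    congr 2
    ring

/-- The event that exactly `n` waiting times have elapsed at time `s`. -/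
def elapsed (n : ℕ) (s : ℝ) : Set (ℕ → ℝ × Space d) :=
  {w | (partialSum n w).1 ≤ s ∧ s < (partialSum n w).1 + (w n).1}

lemma measurableSet_elapsed (n : ℕ) (s : ℝ) : MeasurableSet (elapsed (d := d) n s) :=
  have hp := measurable_partialSum (d := d) n
  measurableSet_le_lt_add (by fun_prop) (by fun_prop) s

/-- The number of jumps is Poisson and independent of the jump sizes. The next waiting time exceeds
the remaining time `s - T` with probability `e^{-(s-T)}`, the weight of index 0; the first `n`
waiting times then raise this index to `n`. -/
lemma setLIntegral_elapsed (n : ℕ) (s : ℝ) (h : Space d → ℝ≥0∞) (hh : Measurable h) :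
    ∫⁻ w in elapsed n s, h (partialSum n w).2 ∂markedLaw ρ
      = poissonWeight n s * ∫⁻ w, h (partialSum n w).2 ∂markedLaw ρ := by
  have hp := measurable_partialSum (d := d) n
  have hE : MeasurableSet {y : (ℝ × Space d) × (ℝ × Space d) | y.1.1 ≤ s ∧ s < y.1.1 + y.2.1} :=
    measurableSet_le_lt_add (by fun_prop) (by fun_prop) s
  have e1 := lintegral_partialSum_and_next ρ n
    (fun y => (if y.1.1 ≤ s ∧ s < y.1.1 + y.2.1 then 1 else 0) * h y.1.2)
    ((Measurable.ite hE (by fun_prop) (by fun_prop)).mul (by fun_prop))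
  rw [← lintegral_indicator (measurableSet_elapsed n s)]
  have e0 : ∀ w : ℕ → ℝ × Space d, (elapsed n s).indicator (fun w => h (partialSum n w).2) w
      = (if (partialSum n w).1 ≤ s ∧ s < (partialSum n w).1 + (w n).1 then 1 else 0) *
        h (partialSum n w).2 := by
    intro w
    simp only [Set.indicator_apply, elapsed, Set.mem_ofPred_eq, ite_mul, one_mul, zero_mul]
  simp_rw [e0]
  -- The integrand does not involve the mark of the next pair, which integrates to one.
  refine e1.trans ((lintegral_const (μ := ρ) (∫⁻ x, ∫⁻ w,
    (if (partialSum n w).1 ≤ s ∧ s < (partialSum n w).1 + x then 1 else 0) *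
      h (partialSum n w).2 ∂markedLaw ρ ∂expMeasure 1)).trans ?_)
  rw [measure_univ, mul_one]
  have hM : Measurable fun y : ℝ × (ℕ → ℝ × Space d) =>
      (if (partialSum n y.2).1 ≤ s ∧ s < (partialSum n y.2).1 + y.1 then 1 else 0 : ℝ≥0∞) *
        h (partialSum n y.2).2 :=
    (Measurable.ite (measurableSet_le_lt_add (by fun_prop) (by fun_prop) s)
      (by fun_prop) (by fun_prop)).mul (by fun_prop)
  rw [lintegral_lintegral_swap hM.aemeasurable]
  have : ∀ w : ℕ → ℝ × Space d,
      ∫⁻ x, (if (partialSum n w).1 ≤ s ∧ s < (partialSum n w).1 + x then 1 else 0 : ℝ≥0∞) *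
        h (partialSum n w).2 ∂expMeasure 1
      = poissonWeight 0 (s - (partialSum n w).1) * h (partialSum n w).2 := by
    intro w
    rw [lintegral_mul_const, lintegral_expMeasure_waiting]
    exact Measurable.ite (measurableSet_le_lt_add (by fun_prop) (by fun_prop) s)
      (by fun_prop) (by fun_prop)
  simp_rw [this]
  rw [lintegral_poissonWeight_partialSum ρ n 0 s h hh, zero_add]

lemma tsum_poissonWeight (s : ℝ) (hs : 0 ≤ s) : ∑' n, poissonWeight n s = 1 := by
  have h : HasSum (fun n : ℕ => Real.exp (-s) * s ^ n / n.factorial) 1 :=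
    hasSum_one_poissonMeasure ⟨s, hs⟩
  simp only [poissonWeight, if_pos hs]
  rw [← ENNReal.ofReal_tsum_of_nonneg (fun n => by positivity) h.summable, h.tsum_eq,
    ENNReal.ofReal_one]

lemma measurable_jumpCount (r t : ℝ) : Measurable (jumpCount (d := d) r t) := by
  refine measurable_ncard.comp (measurable_set_iff.2 fun n => ?_)
  refine measurableSet_setOfPred.1 ?_
  exact (measurableSet_le (f := fun w : ℕ → ℝ × Space d => ∑ i ∈ Finset.range (n + 1), (w i).1)
    (by fun_prop) measurable_const).congr (Set.ext fun _ => Iff.rfl)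

/-- Positive waiting times make the epochs monotone, so those up to the given time form an initial
segment of length `n`. In particular the set is finite and `Set.ncard` is its true cardinality. -/
lemma jumpCount_eq_of_mem_elapsed {r t : ℝ} {n : ℕ} {w : ℕ → ℝ × Space d}
    (hpos : ∀ i, 0 < (w i).1) (hw : w ∈ elapsed n (r * t)) : jumpCount r t w = n := by
  have hfst : ∀ m, (partialSum m w).1 = ∑ i ∈ Finset.range m, (w i).1 := fun m => by
    simp [partialSum, Prod.fst_sum]
  have hmono : Monotone fun m => ∑ i ∈ Finset.range m, (w i).1 :=
    monotone_nat_of_le_succ fun m => by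
      simp only [Finset.sum_range_succ]; linarith [hpos m]
  obtain ⟨h1, h2⟩ := hw
  rw [hfst] at h1 h2
  rw [← Finset.sum_range_succ] at h2
  have : {m : ℕ | ∑ i ∈ Finset.range (m + 1), (w i).1 ≤ r * t} = Set.Iio n := by
    ext m
    change ∑ i ∈ Finset.range (m + 1), (w i).1 ≤ r * t ↔ m < n
    constructor
    · intro h
      by_contra hm
      have := hmono (show n + 1 ≤ m + 1 by omega)
      simp only at this
      linarith
    · intro h
      exact (hmono (show m + 1 ≤ n by omega)).trans h1
  rw [jumpCount, this, ← Finset.coe_Iio, Set.ncard_coe_finset, Nat.card_Iio]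

lemma ae_pos_markedLaw : ∀ᵐ w ∂markedLaw ρ, ∀ i, 0 < (w i).1 := by
  refine ae_all_iff.2 fun i => ?_
  have h : Measure.map (fun w : ℕ → ℝ × Space d => w i) (markedLaw ρ) = (expMeasure 1).prod ρ :=
    Measure.infinitePi_map_eval _ i
  have h2 : ∀ᵐ y ∂(expMeasure 1).prod ρ, 0 < y.1 :=
    Measure.quasiMeasurePreserving_fst.ae ae_pos_expMeasure_one
  rw [← h] at h2
  exact ae_of_ae_map (measurable_pi_apply i).aemeasurable h2

/-- The sum of the marks up to the number of elapsed waiting times. -/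
noncomputable def displacement (r t : ℝ) (w : ℕ → ℝ × Space d) : Space d :=
  ∑ i ∈ Finset.range (jumpCount r t w), (w i).2

lemma measurable_displacement (r t : ℝ) : Measurable (displacement (d := d) r t) := by
  have h : Measurable fun y : ℕ × (ℕ → ℝ × Space d) => ∑ i ∈ Finset.range y.1, (y.2 i).2 :=
    measurable_from_prod_countable_right fun n =>
      Finset.measurable_fun_sum (Finset.range n) (f := fun i (y : ℕ → ℝ × Space d) => (y i).2)
        fun i _ => (measurable_pi_apply i).snd
  exact h.comp ((measurable_jumpCount r t).prodMk measurable_id)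

/-- Decompose according to the number of jumps. The events `elapsed n` are almost surely disjoint
because they determine `jumpCount`. -/
lemma lintegral_displacement (r t : ℝ) (hrt : 0 ≤ r * t) (h : Space d → ℝ≥0∞) (hh : Measurable h) :
    ∫⁻ w, h (displacement r t w) ∂markedLaw ρ
      = ∑' n, poissonWeight n (r * t) * ∫⁻ w, h (partialSum n w).2 ∂markedLaw ρ := by
  have hpos := ae_pos_markedLaw ρ
  have hdisj : Pairwise (Function.onFun (AEDisjoint (markedLaw ρ))
      fun n => elapsed (d := d) n (r * t)) := by
    intro m n hmn
    refine measure_mono_null ?_ hpos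
    intro w hw hw'
    exact hmn ((jumpCount_eq_of_mem_elapsed hw' hw.1).symm.trans
      (jumpCount_eq_of_mem_elapsed hw' hw.2))
  have hmeas : ∀ n, NullMeasurableSet (elapsed (d := d) n (r * t)) (markedLaw ρ) :=
    fun n => (measurableSet_elapsed n _).nullMeasurableSet
  -- The Poisson weights sum to one, so the events exhaust the space; no separate argument that the
  -- waiting times have divergent sum is needed.
  have hfull : (⋃ n, elapsed (d := d) n (r * t)) =ᵐ[markedLaw ρ] Set.univ := by
    refine ae_eq_univ_iff_measure_eq (NullMeasurableSet.iUnion hmeas) |>.2 ?_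
    rw [measure_iUnion₀ hdisj hmeas, measure_univ, ← tsum_poissonWeight _ hrt]
    refine tsum_congr fun n => ?_
    have := setLIntegral_elapsed ρ n (r * t) (fun _ => 1) measurable_const
    simpa using this
  rw [← setLIntegral_univ, ← Measure.restrict_congr_set hfull, lintegral_iUnion₀ hmeas hdisj]
  refine tsum_congr fun n => ?_
  rw [← setLIntegral_elapsed ρ n _ h hh]
  refine setLIntegral_congr_fun_ae (measurableSet_elapsed n _) ?_
  filter_upwards [hpos] with w hw hwE
  rw [displacement, jumpCount_eq_of_mem_elapsed hw hwE, partialSum, Prod.snd_sum]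

/-- The law is the Poisson mixture of the convolution powers of `ρ`. Independence of the marks turns
these into powers of `charFun ρ k`, and the mixture sums to the exponential series. -/
lemma charFun_displacement (r t : ℝ) (hrt : 0 ≤ r * t) (k : Space d) :
    charFun ((markedLaw ρ).map (displacement r t)) k
      = Complex.exp (((r * t : ℝ) : ℂ) * (charFun ρ k - 1)) := by
  have hS : ∀ n, Measurable fun w : ℕ → ℝ × Space d => (partialSum n w).2 :=
    fun n => (measurable_partialSum n).snd
  have hD := measurable_displacement (d := d) r t
  have hlaw : (markedLaw ρ).map (displacement r t) = Measure.sum fun n =>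
      poissonWeight n (r * t) • (markedLaw ρ).map fun w => (partialSum n w).2 := by
    ext B hB
    rw [Measure.map_apply hD hB, Measure.sum_apply _ hB]
    have := lintegral_displacement ρ r t hrt (B.indicator 1) (measurable_one.indicator hB)
    rw [← lintegral_map (measurable_one.indicator hB) hD, lintegral_indicator_one hB,
      Measure.map_apply hD hB] at this
    rw [this]
    refine tsum_congr fun n => ?_
    rw [← lintegral_map (measurable_one.indicator hB) (hS n), lintegral_indicator_one hB]
    simp
  have hpow : ∀ n, charFun ((markedLaw ρ).map fun w => (partialSum n w).2) k
      = charFun ρ k ^ n := by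
    intro n
    have hI : iIndepFun (fun (i : ℕ) (w : ℕ → ℝ × Space d) => (w i).2) (markedLaw ρ) :=
      iIndepFun_infinitePi (X := fun _ (x : ℝ × Space d) => x.2) (by fun_prop)
    have h1 := iIndepFun.charFun_map_fun_finsetSum_eq_prod (s := Finset.range n)
      (X := fun (i : ℕ) (w : ℕ → ℝ × Space d) => (w i).2)
      (fun i _ => (measurable_pi_apply i).snd.aemeasurable) (show iIndepFun (fun (i : Finset.range n) (w : ℕ → ℝ × Space d) => (w i).2) (markedLaw ρ)
        from hI.precomp Subtype.val_injective)
    have h2 : ∀ i, Measure.map (fun w : ℕ → ℝ × Space d => (w i).2) (markedLaw ρ) = ρ := by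
      intro i
      have h : Measure.map (fun w : ℕ → ℝ × Space d => w i) (markedLaw ρ)
          = (expMeasure 1).prod ρ := Measure.infinitePi_map_eval _ i
      rw [show (fun w : ℕ → ℝ × Space d => (w i).2) = Prod.snd ∘ fun w => w i from rfl,
        ← Measure.map_map measurable_snd (measurable_pi_apply i), h, Measure.map_snd_prod,
        measure_univ, one_smul]
    simp only [partialSum, Prod.snd_sum, h1, h2, Finset.prod_const, Finset.card_range,
      Pi.pow_apply]
  have hprob : IsProbabilityMeasure ((markedLaw ρ).map (displacement r t)) :=
    Measure.isProbabilityMeasure_map hD.aemeasurable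
  have hint : Integrable (fun x => Complex.exp ((inner ℝ x k : ℝ) * Complex.I))
      ((markedLaw ρ).map (displacement r t)) := by
    refine Integrable.of_bound (Continuous.aestronglyMeasurable (by fun_prop)) 1 ?_
    exact Eventually.of_forall fun _ => by rw [Complex.norm_exp_ofReal_mul_I]
  rw [charFun_apply]
  rw [hlaw] at hint ⊢
  rw [integral_sum_measure hint]
  simp_rw [integral_smul_measure, ← charFun_apply, hpow, poissonWeight, if_pos hrt]
  have hexp : HasSum (fun n : ℕ => (((r * t : ℝ) : ℂ) * charFun ρ k) ^ n / n.factorial)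
      (Complex.exp (((r * t : ℝ) : ℂ) * charFun ρ k)) := by
    rw [Complex.exp_eq_exp_ℂ]; exact NormedSpace.expSeries_div_hasSum_exp _
  have h3 := (hexp.mul_left (Complex.exp (-((r * t : ℝ) : ℂ)))).tsum_eq
  rw [mul_sub, mul_one, sub_eq_neg_add, Complex.exp_add, ← h3]
  refine tsum_congr fun n => ?_
  rw [ENNReal.toReal_ofReal (by positivity), Complex.real_smul]
  push_cast
  rw [mul_pow]
  ring

end Renewal


/-! ### Normalized measures -/

section Normalized

variable {α : Type*} [MeasurableSpace α] [Inhabited α]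

instance isProbabilityMeasure_normalized (μ : Measure α) : IsProbabilityMeasure (normalized μ) := by
  unfold normalized
  split_ifs with h
  · refine ⟨?_⟩
    rw [Measure.smul_apply, smul_eq_mul, ENNReal.inv_mul_cancel h.1 h.2]
  · infer_instance

lemma normalized_of_ne_zero (μ : Measure α) [IsFiniteMeasure μ] (h : μ Set.univ ≠ 0) :
    normalized μ = (μ Set.univ)⁻¹ • μ :=
  if_pos ⟨h, measure_ne_top _ _⟩

/-- Keeping the mass as a factor covers the zero measure as well, where `normalized` is a Dirac
measure but both sides vanish. -/
lemma mul_integral_normalized {E : Type*} [NormedAddCommGroup E] [NormedSpace ℝ E]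
    (μ : Measure α) [IsFiniteMeasure μ] (g : α → E) :
    μ.real Set.univ • ∫ x, g x ∂normalized μ = ∫ x, g x ∂μ := by
  by_cases h : μ Set.univ = 0
  · rw [Measure.measure_univ_eq_zero.1 h]; simp
  · rw [normalized_of_ne_zero μ h, integral_smul_measure, smul_smul, ENNReal.toReal_inv,
      measureReal_def, mul_inv_cancel₀, one_smul]
    exact ENNReal.toReal_ne_zero.2 ⟨h, measure_ne_top _ _⟩

end Normalized

/-! ### The configurations produced by `scatter` -/

variable {d : ℕ}

lemma measurableSet_shell (n : ℕ) : MeasurableSet (shell d n) :=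
  ((measurableSet_le measurable_const measurable_norm).inter
    (measurableSet_lt measurable_norm measurable_const)).congr (Set.ext fun _ => Iff.rfl)

lemma mem_shell_iff {n : ℕ} {x : Space d} : x ∈ shell d n ↔ ⌊‖x‖⌋₊ = n :=
  (Nat.floor_eq_iff (norm_nonneg x)).symm

/-- The `i`-th term of `u` lies in the `n`-th shell and does not occur earlier in the sequence. -/
def firstIndex (i : ℕ) (n : ℕ) (u : ℕ → Space d) : Prop :=
  u i ∈ shell d n ∧ ∀ j < i, u j ≠ u i

open Classical in
-- A configuration is a set, so a point hit by several indices must count once; `firstIndex` selects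
-- the earliest of them. The formula thus holds for every `w`, not just almost surely, which is what
-- measurability of `scatter` requires.
lemma pairing_scatter (f : Space d → ℝ) (M : ℕ) (hf : ∀ x, (M : ℝ) ≤ ‖x‖ → f x = 0)
    (w : ℕ → ℕ × (ℕ → Space d)) :
    pairing f (scatter w) = ∑ n ∈ Finset.range M, ∑ i ∈ Finset.range (w n).1,
      if firstIndex i n (w n).2 then f ((w n).2 i) else 0 := by
  set T : Finset (Σ _ : ℕ, ℕ) := ((Finset.range M).sigma fun n => Finset.range (w n).1).filter
    fun p => firstIndex p.2 p.1 (w p.1).2 with hT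
  have hTmem : ∀ p : Σ _ : ℕ, ℕ, p ∈ T ↔ (p.1 < M ∧ p.2 < (w p.1).1) ∧
      firstIndex p.2 p.1 (w p.1).2 := fun p => by simp [hT]
  rw [← Finset.sum_sigma (Finset.range M) (fun n => Finset.range (w n).1)
    (fun p => if firstIndex p.2 p.1 (w p.1).2 then f ((w p.1).2 p.2) else 0),
    ← Finset.sum_filter, ← hT]
  have hinj : Set.InjOn (fun p : Σ _ : ℕ, ℕ => (w p.1).2 p.2) T := by
    rintro ⟨n, i⟩ hp ⟨m, j⟩ hq h
    have hp := (hTmem _).1 hp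
    have hq := (hTmem _).1 hq
    simp only at h hp hq
    have hnm : n = m := by
      rw [← mem_shell_iff.1 hp.2.1, ← mem_shell_iff.1 hq.2.1, h]
    subst hnm
    rcases lt_trichotomy i j with hij | hij | hij
    · exact absurd h (hq.2.2 i hij)
    · rw [hij]
    · exact absurd h.symm (hp.2.2 j hij)
  have hmem : ∀ p ∈ T, (w p.1).2 p.2 ∈ (scatter w).1 := fun p hp =>
    ⟨p.1, p.2, ((hTmem p).1 hp).1.2, rfl, ((hTmem p).1 hp).2.1⟩
  rw [pairing, tsum_subtype (scatter w).1 f,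
    tsum_eq_sum (s := T.image fun p => (w p.1).2 p.2), Finset.sum_image hinj]
  · exact Finset.sum_congr rfl fun p hp => Set.indicator_of_mem (hmem p hp) _
  · intro x hx
    by_contra hne
    have hxs : x ∈ (scatter w).1 := Set.mem_of_indicator_ne_zero hne
    rw [Set.indicator_of_mem hxs] at hne
    obtain ⟨n, i, hi, hix, hxn⟩ := hxs
    have hex : ∃ j, j < (w n).1 ∧ (w n).2 j = x := ⟨i, hi, hix⟩
    -- The least index at which the sequence takes the value `x` satisfies `firstIndex`.
    refine hx (Finset.mem_image.2 ⟨⟨n, Nat.find hex⟩, (hTmem _).2 ⟨⟨?_, (Nat.find_spec hex).1⟩,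
      ?_, ?_⟩, (Nat.find_spec hex).2⟩)
    · by_contra hnM
      refine hne (hf x (le_trans ?_ hxn.1))
      exact_mod_cast not_lt.1 hnM
    · simp only [(Nat.find_spec hex).2, hxn]
    · intro j hj hjx
      exact Nat.find_min hex hj ⟨hj.trans (Nat.find_spec hex).1, hjx.trans (Nat.find_spec hex).2⟩

lemma exists_nat_forall_le_norm_eq_zero {f : Space d → ℝ} (hf : HasCompactSupport f) :
    ∃ M : ℕ, ∀ x, (M : ℝ) ≤ ‖x‖ → f x = 0 := by
  obtain ⟨R, hR⟩ := hf.isCompact.isBounded.exists_norm_le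
  obtain ⟨M, hM⟩ := exists_nat_gt R
  refine ⟨M, fun x hx => image_eq_zero_of_notMem_tsupport fun h => ?_⟩
  linarith [hR x h]

lemma measurable_pairing {f : Space d → ℝ} (hc : Continuous f) (hf : HasCompactSupport f) :
    Measurable (pairing f) := by
  refine Measurable.mono (comap_measurable (m := borel ℝ) (pairing f)) ?_
    (BorelSpace.measurable_eq (α := ℝ)).le
  exact le_iSup₂_of_le f ⟨hc, hf⟩ le_rfl

lemma measurable_scatter : Measurable (scatter (d := d)) := by
  classical
  rw [measurable_iff_comap_le, instMeasurableSpaceConfig]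
  simp only [MeasurableSpace.comap_iSup, MeasurableSpace.comap_comp]
  refine iSup₂_le fun f hf => ?_
  rw [← BorelSpace.measurable_eq (α := ℝ), ← measurable_iff_comap_le]
  obtain ⟨M, hM⟩ := exists_nat_forall_le_norm_eq_zero hf.2
  have h : pairing f ∘ scatter = fun w => ∑ n ∈ Finset.range M, ∑ i ∈ Finset.range (w n).1,
      if firstIndex i n (w n).2 then f ((w n).2 i) else 0 :=
    funext fun w => pairing_scatter f M hM w
  rw [h]
  refine Finset.measurable_fun_sum _ fun n _ => ?_
  have hg : Measurable fun y : ℕ × (ℕ → Space d) => ∑ i ∈ Finset.range y.1,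
      if firstIndex i n y.2 then f (y.2 i) else 0 := by
    refine measurable_from_prod_countable_right fun N => ?_
    refine Finset.measurable_fun_sum (Finset.range N)
      (f := fun i (u : ℕ → Space d) => if firstIndex i n u then f (u i) else 0) fun i _ => ?_
    refine Measurable.ite ?_ (hf.1.measurable.comp (measurable_pi_apply i)) measurable_const
    have h1 : MeasurableSet {u : ℕ → Space d | u i ∈ shell d n} :=
      measurable_pi_apply i (measurableSet_shell n)
    have h2 : MeasurableSet (⋂ j ∈ Set.Iio i, {u : ℕ → Space d | u j ≠ u i}) :=
      MeasurableSet.biInter (Set.to_countable _) fun j _ =>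
        (measurableSet_eq_fun (measurable_pi_apply j) (measurable_pi_apply i)).compl
    refine (h1.inter h2).congr (Set.ext fun u => ?_)
    simp [firstIndex]
  exact hg.comp (measurable_pi_apply n)

/-! ### The Laplace functional of the Poisson measure -/

section Poisson

variable {z : Space d → ℝ}

lemma isFiniteMeasure_intensity_shell (hz : ∃ C, ∀ x, z x ≤ C) (n : ℕ) :
    IsFiniteMeasure ((intensityMeasure z).restrict (shell d n)) := by
  obtain ⟨C, hC⟩ := hz
  refine ⟨?_⟩
  rw [Measure.restrict_apply_univ, intensityMeasure, withDensity_apply _ (measurableSet_shell n)]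
  refine (lintegral_mono fun x => ENNReal.ofReal_le_ofReal (hC x)).trans_lt ?_
  rw [setLIntegral_const]
  refine ENNReal.mul_lt_top ENNReal.ofReal_lt_top ?_
  refine (measure_mono (t := Metric.closedBall 0 (n + 1)) fun x hx => ?_).trans_lt
    measure_closedBall_lt_top
  simpa using hx.2.le

/-- The law of the number of points and the points in the `n`-th shell. -/
noncomputable def shellLaw (z : Space d → ℝ) (n : ℕ) : Measure (ℕ × (ℕ → Space d)) :=
  (poissonMeasure (intensityMeasure z (shell d n)).toNNReal).prod
    (Measure.infinitePi fun _ : ℕ => normalized ((intensityMeasure z).restrict (shell d n)))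

instance (n : ℕ) : IsProbabilityMeasure (shellLaw z n) := by
  unfold shellLaw; infer_instance

lemma poissonConfig_eq (z : Space d → ℝ) :
    poissonConfig z = (Measure.infinitePi fun n => shellLaw z n).map scatter := rfl

instance (z : Space d → ℝ) : IsProbabilityMeasure (poissonConfig z) := by
  rw [poissonConfig_eq]
  exact Measure.isProbabilityMeasure_map measurable_scatter.aemeasurable

/-- The normalized law on a shell is absolutely continuous, hence without atoms when `d ≥ 1`, and
independent points are almost surely distinct. On a shell of zero intensity the points would all
coincide under the default Dirac law, but then the number of points is almost surely zero; hence the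
restriction to `i < y.1`. -/
lemma ae_firstIndex [NeZero d] (hz : ∃ C, ∀ x, z x ≤ C) (n : ℕ) :
    ∀ᵐ y ∂shellLaw z n, ∀ i < y.1, firstIndex i n y.2 := by
  have := isFiniteMeasure_intensity_shell hz n
  by_cases h0 : intensityMeasure z (shell d n) = 0
  · have h1 : ∀ᵐ N ∂poissonMeasure (intensityMeasure z (shell d n)).toNNReal, N = 0 := by
      rw [h0, ENNReal.toNNReal_zero]
      refine (prob_compl_eq_zero_iff (MeasurableSet.of_discrete (s := {0}))).2 ?_
      rw [poissonMeasure_singleton]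
      simp
    have h2 : ∀ᵐ y ∂shellLaw z n, y.1 = 0 := Measure.quasiMeasurePreserving_fst.ae h1
    filter_upwards [h2] with y hy i hi
    omega
  · set ν := normalized ((intensityMeasure z).restrict (shell d n)) with hν
    have hne : (intensityMeasure z).restrict (shell d n) Set.univ ≠ 0 := by
      rwa [Measure.restrict_apply_univ]
    have hνeq := normalized_of_ne_zero _ hne
    have hac : ν ≪ (intensityMeasure z).restrict (shell d n) := by
      rw [hν, hνeq]; exact Measure.smul_absolutelyContinuous
    have hac2 : ν ≪ volume := hac.trans
      (Measure.absolutelyContinuous_of_le Measure.restrict_le_self |>.trans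
        (withDensity_absolutelyContinuous _ _))
    have hatom : ∀ x, ν {x} = 0 := fun x => hac2 (measure_singleton x)
    have h1 : ∀ i, ∀ᵐ u ∂Measure.infinitePi fun _ : ℕ => ν, u i ∈ shell d n := by
      intro i
      have : ∀ᵐ x ∂ν, x ∈ shell d n := hac.ae_le (ae_restrict_mem (measurableSet_shell n))
      rw [← Measure.infinitePi_map_eval (fun _ : ℕ => ν) i] at this
      exact ae_of_ae_map (measurable_pi_apply i).aemeasurable this
    have h2 : ∀ i j : ℕ, j ≠ i → ∀ᵐ u ∂Measure.infinitePi fun _ : ℕ => ν, u j ≠ u i := by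
      intro i j hij
      have hd : MeasurableSet {p : Space d × Space d | p.1 = p.2} :=
        measurableSet_eq_fun measurable_fst measurable_snd
      have : ∀ᵐ p ∂ν.prod ν, p.1 ≠ p.2 := by
        have h := (Measure.measure_prod_null (μ := ν) (ν := ν) hd).2
          (Eventually.of_forall fun x => by
            refine measure_mono_null (t := {x}) (fun y hy => ?_) (hatom x)
            exact (Eq.symm hy : y = x))
        refine measure_mono_null (fun p hp => ?_) h
        simpa using hp
      rw [← Measure.infinitePi_map_eval_prod (P := fun _ : ℕ => ν) hij] at this
      exact ae_of_ae_map (f := fun u : ℕ → Space d => (u j, u i)) (by fun_prop) this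
    have h3 : ∀ᵐ u ∂Measure.infinitePi fun _ : ℕ => ν, ∀ i, firstIndex i n u := by
      refine ae_all_iff.2 fun i => ?_
      have : ∀ᵐ u ∂Measure.infinitePi fun _ : ℕ => ν, ∀ j, j ≠ i → u j ≠ u i :=
        ae_all_iff.2 fun j => ae_all_iff.2 fun hij => h2 i j hij
      filter_upwards [h1 i, this] with u hu hu2
      exact ⟨hu, fun j hj => hu2 j hj.ne⟩
    have h4 : ∀ᵐ y ∂shellLaw z n, ∀ i, firstIndex i n y.2 :=
      Measure.quasiMeasurePreserving_snd.ae h3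
    filter_upwards [h4] with y hy i _ using hy i

lemma lintegral_pow_poissonMeasure (r : ℝ≥0) (m : ℝ) (hm : 0 ≤ m) :
    ∫⁻ N, ENNReal.ofReal m ^ N ∂poissonMeasure r = ENNReal.ofReal (Real.exp (r * (m - 1))) := by
  rw [poissonMeasure, lintegral_sum_measure]
  simp_rw [lintegral_smul_measure, lintegral_dirac, smul_eq_mul, ← ENNReal.ofReal_pow hm]
  have h1 : ∀ n : ℕ, ENNReal.ofReal (Real.exp (-(r : ℝ)) * (r : ℝ) ^ n / n.factorial) *
      ENNReal.ofReal (m ^ n)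
      = ENNReal.ofReal (Real.exp (-(r : ℝ)) * ((r * m) ^ n / n.factorial)) := fun n => by
    rw [← ENNReal.ofReal_mul (by positivity), mul_pow]; congr 1; ring
  simp_rw [h1]
  have h2 : HasSum (fun n : ℕ => ((r : ℝ) * m) ^ n / n.factorial) (Real.exp (r * m)) := by
    rw [Real.exp_eq_exp_ℝ]; exact NormedSpace.expSeries_div_hasSum_exp _
  have h3 := h2.mul_left (Real.exp (-(r : ℝ)))
  rw [← ENNReal.ofReal_tsum_of_nonneg (fun n => by positivity) h3.summable, h3.tsum_eq,
    ← Real.exp_add]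
  congr 2
  ring

lemma integral_intensityMeasure (hzm : Measurable z) (hz0 : ∀ x, 0 ≤ z x) (s : Set (Space d))
    (hs : MeasurableSet s) (g : Space d → ℝ) :
    ∫ x in s, g x ∂intensityMeasure z = ∫ x in s, z x * g x := by
  rw [intensityMeasure, restrict_withDensity hs,
    integral_withDensity_eq_integral_toReal_smul (by fun_prop) (by simp)]
  simp [ENNReal.toReal_ofReal (hz0 _)]

/-- Given `N` points, independence gives the `N`-th power of the mean of `F`. The Poisson generating
function then gives `exp (r (m - 1))`, and the parameter `r` cancels the normalization hidden in
`m`. -/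
lemma lintegral_shellLaw (hzm : Measurable z) (hz0 : ∀ x, 0 ≤ z x) (hz : ∃ C, ∀ x, z x ≤ C)
    (n : ℕ) {F : Space d → ℝ} (hF : Measurable F) (hF0 : ∀ x, 0 ≤ F x) (hFb : ∃ C, ∀ x, F x ≤ C) :
    ∫⁻ y, ∏ i ∈ Finset.range y.1, ENNReal.ofReal (F (y.2 i)) ∂shellLaw z n
      = ENNReal.ofReal (Real.exp (∫ x in shell d n, z x * (F x - 1))) := by
  have := isFiniteMeasure_intensity_shell hz n
  set ν := normalized ((intensityMeasure z).restrict (shell d n)) with hν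
  have hm : Measurable fun y : ℕ × (ℕ → Space d) =>
      ∏ i ∈ Finset.range y.1, ENNReal.ofReal (F (y.2 i)) :=
    measurable_from_prod_countable_right fun N =>
      Finset.measurable_fun_prod (Finset.range N)
        (f := fun i (u : ℕ → Space d) => ENNReal.ofReal (F (u i))) fun i _ => by fun_prop
  have hFi : Integrable F ν := by
    obtain ⟨C, hC⟩ := hFb
    refine Integrable.of_bound hF.aestronglyMeasurable C (Eventually.of_forall fun x => ?_)
    rw [Real.norm_of_nonneg (hF0 x)]; exact hC x
  rw [shellLaw, ← hν, lintegral_prod _ hm.aemeasurable]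
  have h1 : ∀ N : ℕ, ∫⁻ u, ∏ i ∈ Finset.range N, ENNReal.ofReal (F (u i))
      ∂(Measure.infinitePi fun _ : ℕ => ν) = ENNReal.ofReal (∫ x, F x ∂ν) ^ N := by
    intro N
    have hI : iIndepFun (fun (i : ℕ) (u : ℕ → Space d) => ENNReal.ofReal (F (u i)))
        (Measure.infinitePi fun _ : ℕ => ν) :=
      iIndepFun_infinitePi (X := fun _ x => ENNReal.ofReal (F x)) (by fun_prop)
    rw [lintegral_prod_eq_prod_lintegral_of_indepFun _ _ hI (by fun_prop)]
    have : ∀ i : ℕ, ∫⁻ u : ℕ → Space d, ENNReal.ofReal (F (u i))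
        ∂(Measure.infinitePi fun _ : ℕ => ν) = ENNReal.ofReal (∫ x, F x ∂ν) := by
      intro i
      rw [← lintegral_map (f := fun x => ENNReal.ofReal (F x)) (by fun_prop)
        (measurable_pi_apply i), Measure.infinitePi_map_eval,
        ofReal_integral_eq_lintegral_ofReal hFi (Eventually.of_forall hF0)]
    simp_rw [this, Finset.prod_const, Finset.card_range]
  simp_rw [h1]
  rw [lintegral_pow_poissonMeasure _ _ (integral_nonneg hF0),
    ← integral_intensityMeasure hzm hz0 _ (measurableSet_shell n),
    ← mul_integral_normalized ((intensityMeasure z).restrict (shell d n)),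
    integral_sub hFi (integrable_const _)]
  rw [measureReal_def, Measure.restrict_apply_univ]
  simp only [integral_const, probReal_univ, smul_eq_mul, mul_one]
  rfl

/-- The shells are independent and only finitely many of them meet the support of `F - 1`, so the
answer is a finite product of shell contributions. Almost surely no point is repeated, and the
pairing is the plain sum over the sampled points. -/
lemma lintegral_exp_pairing_poissonConfig [NeZero d] (hzm : Measurable z) (hz0 : ∀ x, 0 ≤ z x)
    (hz : ∃ C, ∀ x, z x ≤ C) {F : Space d → ℝ} (hF : Continuous F) (hF0 : ∀ x, 0 < F x)
    (hFs : HasCompactSupport fun x => F x - 1) :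
    ∫⁻ γ, ENNReal.ofReal (Real.exp (pairing (fun x => Real.log (F x)) γ)) ∂poissonConfig z
      = ENNReal.ofReal (Real.exp (∫ x, z x * (F x - 1))) := by
  classical
  obtain ⟨M, hM⟩ := exists_nat_forall_le_norm_eq_zero hFs
  have hlog : HasCompactSupport fun x => Real.log (F x) :=
    HasCompactSupport.mono' hFs fun x hx => by
      refine subset_tsupport _ fun h => hx ?_
      have h : F x - 1 = 0 := h
      simp [show F x = 1 by linarith]
  have hlogc : Continuous fun x => Real.log (F x) := hF.log fun x => (hF0 x).ne'
  obtain ⟨C, hC⟩ := (hF.sub continuous_const).bounded_above_of_compact_support hFs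
  have hFb : ∃ C, ∀ x, F x ≤ C := ⟨C + 1, fun x => by
    have : F x - 1 ≤ C := (le_abs_self _).trans (hC x)
    linarith⟩
  have hmp := measurable_pairing hlogc hlog
  rw [poissonConfig_eq, lintegral_map (by fun_prop) measurable_scatter]
  have hae : ∀ᵐ w ∂Measure.infinitePi fun n => shellLaw z n,
      ∀ n, ∀ i < (w n).1, firstIndex i n (w n).2 := by
    refine ae_all_iff.2 fun n => ?_
    have := ae_firstIndex hz n
    rw [← Measure.infinitePi_map_eval (fun n => shellLaw z n) n] at this
    exact ae_of_ae_map (measurable_pi_apply n).aemeasurable this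
  have h1 : ∀ᵐ w ∂Measure.infinitePi fun n => shellLaw z n,
      ENNReal.ofReal (Real.exp (pairing (fun x => Real.log (F x)) (scatter w)))
      = ∏ n ∈ Finset.range M, ∏ i ∈ Finset.range (w n).1, ENNReal.ofReal (F ((w n).2 i)) := by
    filter_upwards [hae] with w hw
    rw [pairing_scatter _ M (fun x hx => by
      have := hM x hx
      rw [show F x = 1 by linarith, Real.log_one]), Real.exp_sum,
      ENNReal.ofReal_prod_of_nonneg fun n _ => (Real.exp_pos _).le]
    refine Finset.prod_congr rfl fun n _ => ?_
    rw [Real.exp_sum, ENNReal.ofReal_prod_of_nonneg fun n _ => (Real.exp_pos _).le]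
    refine Finset.prod_congr rfl fun i hi => ?_
    rw [if_pos (hw n i (Finset.mem_range.1 hi)), Real.exp_log (hF0 _)]
  rw [lintegral_congr_ae h1]
  have hm : Measurable fun y : ℕ × (ℕ → Space d) =>
      ∏ i ∈ Finset.range y.1, ENNReal.ofReal (F (y.2 i)) :=
    measurable_from_prod_countable_right fun N =>
      Finset.measurable_fun_prod (Finset.range N)
        (f := fun i (u : ℕ → Space d) => ENNReal.ofReal (F (u i))) fun i _ => by fun_prop
  have hI := iIndepFun_infinitePi (P := fun n => shellLaw z n) (X := fun _ y =>
      ∏ i ∈ Finset.range y.1, ENNReal.ofReal (F (y.2 i))) (fun _ => hm)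
  rw [lintegral_prod_eq_prod_lintegral_of_indepFun (Finset.range M) _ hI
    (fun n => hm.comp (measurable_pi_apply n))]
  have h2 : ∀ n : ℕ, ∫⁻ w, ∏ i ∈ Finset.range (w n).1, ENNReal.ofReal (F ((w n).2 i))
      ∂(Measure.infinitePi fun n => shellLaw z n)
      = ENNReal.ofReal (Real.exp (∫ x in shell d n, z x * (F x - 1))) := by
    intro n
    rw [← lintegral_shellLaw hzm hz0 hz n hF.measurable (fun x => (hF0 x).le) hFb,
      ← Measure.infinitePi_map_eval (fun n => shellLaw z n) n,
      lintegral_map hm (measurable_pi_apply n)]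
  simp_rw [h2]
  rw [← ENNReal.ofReal_prod_of_nonneg fun n _ => (Real.exp_pos _).le, ← Real.exp_sum]
  have hint : Integrable fun x => z x * (F x - 1) := by
    obtain ⟨B, hB⟩ := hz
    refine Integrable.bdd_mul (c := B)
      ((hF.sub continuous_const).integrable_of_hasCompactSupport hFs)
      hzm.aestronglyMeasurable (Eventually.of_forall fun x => ?_)
    rw [Real.norm_of_nonneg (hz0 x)]; exact hB x
  rw [← integral_biUnion_finset _ (fun n _ => measurableSet_shell n) ?_
    (fun n _ => hint.integrableOn)]
  · rw [setIntegral_eq_integral_of_forall_compl_eq_zero]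
    intro x hx
    rw [hM x, mul_zero]
    by_contra hxM
    refine hx (Set.mem_biUnion (x := ⌊‖x‖⌋₊) ?_ (mem_shell_iff.2 rfl))
    simp only [Finset.coe_range, Set.mem_Iio]
    exact (Nat.floor_lt (norm_nonneg x)).2 (not_le.1 hxM)
  · intro n _ m _ hnm
    refine Set.disjoint_left.2 fun x hx hx' => hnm ?_
    rw [← mem_shell_iff.1 hx, ← mem_shell_iff.1 hx']

end Poisson


/-! ### Pairings with functions vanishing outside a ball -/

lemma exists_finset_forall_norm_lt_mem (γ : Config d) (M : ℕ) :
    ∃ s : Finset γ.1, ∀ x : γ.1, ‖x.1‖ < M → x ∈ s := by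
  have h := γ.2 (Metric.closedBall 0 M) (isCompact_closedBall 0 _)
  have h2 : (Subtype.val ⁻¹' (Metric.closedBall (0 : Space d) M) : Set γ.1).Finite := by
    refine Set.Finite.of_finite_image (h.subset ?_) Subtype.val_injective.injOn
    rintro _ ⟨x, hx, rfl⟩
    exact ⟨x.2, hx⟩
  exact ⟨h2.toFinset, fun x hx => h2.mem_toFinset.2 (by simpa using hx.le)⟩

lemma pairing_mono (γ : Config d) {f g : Space d → ℝ} {M : ℕ} (hf : ∀ x, (M : ℝ) ≤ ‖x‖ → f x = 0)
    (hg : ∀ x, (M : ℝ) ≤ ‖x‖ → g x = 0) (hfg : ∀ x, f x ≤ g x) : pairing f γ ≤ pairing g γ := by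
  obtain ⟨s, hs⟩ := exists_finset_forall_norm_lt_mem γ M
  have h : ∀ x : γ.1, x ∉ s → (M : ℝ) ≤ ‖x.1‖ := fun x hx => not_lt.1 fun h => hx (hs x h)
  rw [pairing, pairing, tsum_eq_sum fun x hx => hf _ (h x hx),
    tsum_eq_sum fun x hx => hg _ (h x hx)]
  exact Finset.sum_le_sum fun x _ => hfg _

/-! ### Cutoff functions -/

/-- Continuous compactly supported functions increasing to `1`. -/
noncomputable def cutoff (n : ℕ) (x : Space d) : ℝ := max 0 (min 1 (n - ‖x‖))

lemma continuous_cutoff (n : ℕ) : Continuous (cutoff (d := d) n) := by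
  unfold cutoff; fun_prop

lemma cutoff_nonneg (n : ℕ) (x : Space d) : 0 ≤ cutoff n x := le_max_left _ _

lemma cutoff_le_one (n : ℕ) (x : Space d) : cutoff n x ≤ 1 :=
  max_le zero_le_one (min_le_left _ _)

lemma cutoff_eq_zero {n : ℕ} {x : Space d} (h : (n : ℝ) ≤ ‖x‖) : cutoff n x = 0 :=
  max_eq_left ((min_le_right _ _).trans (by linarith))

lemma cutoff_mono {m n : ℕ} (h : m ≤ n) (x : Space d) : cutoff m x ≤ cutoff n x := by
  have : (m : ℝ) ≤ n := by exact_mod_cast h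
  exact max_le_max le_rfl (min_le_min le_rfl (by linarith))

lemma eventually_cutoff_eq_one (x : Space d) : ∀ᶠ n in atTop, cutoff n x = 1 := by
  filter_upwards [eventually_ge_atTop (⌈‖x‖ + 1⌉₊)] with n hn
  have : ‖x‖ + 1 ≤ n := Nat.ceil_le.1 hn
  rw [cutoff, min_eq_left (by linarith), max_eq_right zero_le_one]

lemma tendsto_cutoff (x : Space d) : Tendsto (fun n => cutoff n x) atTop (𝓝 1) :=
  tendsto_const_nhds.congr' ((eventually_cutoff_eq_one x).mono fun _ h => h.symm)

/-! ### Exponential moments of displaced functions -/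

section Tilt

variable (μ : Measure (Space d)) [IsProbabilityMeasure μ]

/-- The mean of `exp (c ψ(x - s))` over a random displacement `s`. -/
noncomputable def expMean (μ : Measure (Space d)) (ψ : Space d → ℝ) (c : ℝ) (x : Space d) : ℝ :=
  ∫ s, Real.exp (c * ψ (x - s)) ∂μ

variable {ψ : Space d → ℝ} {B : ℝ}

lemma integrable_exp_displaced (hψ : Continuous ψ) (hB : ∀ x, |ψ x| ≤ B) (c : ℝ) (x : Space d) :
    Integrable (fun s => Real.exp (c * ψ (x - s))) μ := by
  refine Integrable.of_bound (Continuous.aestronglyMeasurable (by fun_prop)) (Real.exp (|c| * B))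
    (Eventually.of_forall fun s => ?_)
  rw [Real.norm_of_nonneg (Real.exp_pos _).le, Real.exp_le_exp]
  refine (le_abs_self _).trans ?_
  rw [abs_mul]
  exact mul_le_mul_of_nonneg_left (hB _) (abs_nonneg _)

lemma expMean_pos (hψ : Continuous ψ) (hB : ∀ x, |ψ x| ≤ B) (c : ℝ) (x : Space d) :
    0 < expMean μ ψ c x := integral_exp_pos (integrable_exp_displaced μ hψ hB c x)

@[simp] lemma expMean_zero (x : Space d) : expMean μ ψ 0 x = 1 := by simp [expMean]

lemma expMean_mono {ψ' : Space d → ℝ} (hψ : Continuous ψ) (hB : ∀ x, |ψ x| ≤ B)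
    (hψ' : Continuous ψ') (hB' : ∀ x, |ψ' x| ≤ B) {c c' : ℝ} (x : Space d)
    (h : ∀ y, c * ψ y ≤ c' * ψ' y) : expMean μ ψ c x ≤ expMean μ ψ' c' x :=
  integral_mono (integrable_exp_displaced μ hψ hB c x) (integrable_exp_displaced μ hψ' hB' c' x)
    fun _ => Real.exp_le_exp.2 (h _)

/-- The σ-algebra on configurations is generated by pairings with continuous compactly supported
functions, so continuity in `x` is what makes the truncated moments measurable. -/
lemma continuous_expMean (hψ : Continuous ψ) (hB : ∀ x, |ψ x| ≤ B) {χ : Space d → ℝ}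
    (hχ : Continuous χ) (hχ0 : ∀ x, 0 ≤ χ x) (hχ1 : ∀ x, χ x ≤ 1) :
    Continuous fun x => expMean μ ψ (χ x) x := by
  refine continuous_of_dominated (bound := fun _ => Real.exp B)
    (fun x => (integrable_exp_displaced μ hψ hB _ x).aestronglyMeasurable)
    (fun x => Eventually.of_forall fun s => ?_) (integrable_const _)
    (Eventually.of_forall fun _ => by fun_prop)
  rw [Real.norm_of_nonneg (Real.exp_pos _).le, Real.exp_le_exp]
  refine (le_abs_self _).trans ?_
  rw [abs_mul, abs_of_nonneg (hχ0 x)]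
  exact (mul_le_of_le_one_left (abs_nonneg _) (hχ1 x)).trans (hB _)

/-- By translation invariance all slices in the first variable have the same `L¹` norm, which is
integrable against a probability measure. -/
lemma integrable_prod_displaced {g : Space d → ℝ} (hg : Continuous g) (hgi : Integrable g) :
    Integrable (fun p : Space d × Space d => g (p.1 - p.2)) (volume.prod μ) := by
  refine (integrable_prod_iff' (Continuous.aestronglyMeasurable (by fun_prop))).2
    ⟨Eventually.of_forall fun s => hgi.comp_sub_right s, ?_⟩
  have : ∀ s : Space d, ∫ x, ‖g (x - s)‖ = ∫ x, ‖g x‖ := fun s =>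
    integral_sub_right_eq_self (fun x => ‖g x‖) s
  simp_rw [this]
  exact integrable_const _

lemma integrable_expMean_sub_one (hψ : Continuous ψ) (hs : HasCompactSupport ψ)
    (hB : ∀ x, |ψ x| ≤ B) :
    Integrable fun x => expMean μ (fun y => |ψ y|) 1 x - 1 := by
  have hsup : HasCompactSupport fun x => Real.exp |ψ x| - 1 :=
    HasCompactSupport.comp_left (g := fun y => Real.exp |y| - 1) hs (by simp)
  have hg := Continuous.integrable_of_hasCompactSupport (μ := volume)
    (f := fun x => Real.exp |ψ x| - 1) (by fun_prop) hsup
  have h := (integrable_prod_displaced μ (by fun_prop) hg).integral_prod_left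
  refine h.congr (Eventually.of_forall fun x => ?_)
  have := integrable_exp_displaced μ (ψ := fun y => |ψ y|) (by fun_prop)
    (fun x => (abs_abs _).trans_le (hB x)) 1 x
  simp only [one_mul] at this
  simp only [expMean, one_mul]
  rw [integral_sub this (integrable_const _)]
  simp

/-- From `|e^y - 1| ≤ e^{|y|} - 1`. The bound does not depend on the weight `c`, so it dominates all
truncations at once. -/
lemma abs_expMean_sub_one_le (hψ : Continuous ψ) (hB : ∀ x, |ψ x| ≤ B) {c : ℝ} (hc0 : 0 ≤ c)
    (hc1 : c ≤ 1) (x : Space d) :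
    |expMean μ ψ c x - 1| ≤ expMean μ (fun y => |ψ y|) 1 x - 1 := by
  have hB' : ∀ x, |(|ψ x|)| ≤ B := fun x => (abs_abs _).trans_le (hB x)
  have h1 := integrable_exp_displaced μ hψ hB c x
  have h2 := integrable_exp_displaced μ (ψ := fun y => |ψ y|) (by fun_prop) hB' 1 x
  have e1 : expMean μ ψ c x - 1 = ∫ s, (Real.exp (c * ψ (x - s)) - 1) ∂μ := by
    rw [integral_sub h1 (integrable_const _)]; simp [expMean]
  have e2 : expMean μ (fun y => |ψ y|) 1 x - 1 = ∫ s, (Real.exp (1 * |ψ (x - s)|) - 1) ∂μ := by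
    rw [integral_sub h2 (integrable_const _)]; simp [expMean]
  rw [e1, e2]
  refine (abs_integral_le_integral_abs).trans
    (integral_mono (h1.sub (integrable_const _)).abs (h2.sub (integrable_const _)) fun s => ?_)
  have hy : |c * ψ (x - s)| ≤ |ψ (x - s)| := by
    rw [abs_mul, abs_of_nonneg hc0]; exact mul_le_of_le_one_left (abs_nonneg _) hc1
  set y := c * ψ (x - s)
  have h3 : |Real.exp y - 1| ≤ Real.exp |y| - 1 := by
    rcases le_total 0 y with h | h
    · rw [abs_of_nonneg h, abs_of_nonneg (by linarith [Real.add_one_le_exp y])]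
    · rw [abs_of_nonpos h, abs_of_nonpos (by linarith [Real.exp_le_one_iff.2 h])]
      -- For `y ≤ 0`: `1 - e^y ≤ -y ≤ e^{-y} - 1`.
      nlinarith [Real.add_one_le_exp y, Real.add_one_le_exp (-y)]
  simp only [one_mul]
  linarith [Real.exp_le_exp.2 hy]

end Tilt

/-! ### The free dynamics started at a fixed configuration -/

instance (b : Space d → ℝ) : IsProbabilityMeasure (particleLaw b) :=
  inferInstanceAs (IsProbabilityMeasure (markedLaw (normalized (intensityMeasure b))))

/-- The law of the displacement of a particle up to time `t`. -/
noncomputable def displacementLaw (b : Space d → ℝ) (t : ℝ) : Measure (Space d) :=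
  (particleLaw b).map (displacement (totalRate b) t)

instance (b : Space d → ℝ) (t : ℝ) : IsProbabilityMeasure (displacementLaw b t) :=
  Measure.isProbabilityMeasure_map (measurable_displacement _ _).aemeasurable

section Dynamics

variable (b : Space d → ℝ) (t : ℝ) {ψ : Space d → ℝ} {B : ℝ}

/-- The empirical field of `ψ` with the weight `χ x` given to the particle started at `x`. -/
noncomputable def weightedField (b : Space d → ℝ) (t : ℝ) (ψ : Space d → ℝ) (χ : Space d → ℝ)
    (γ : Config d) (ω : γ.1 → ℕ → ℝ × Space d) : ℝ :=
  ∑' x : γ.1, χ x * ψ (x - displacement (totalRate b) t (ω x))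

lemma weightedField_eq_sum {χ : Space d → ℝ} {M : ℕ} (hχ : ∀ x, (M : ℝ) ≤ ‖x‖ → χ x = 0)
    {γ : Config d} {s : Finset γ.1} (hs : ∀ x : γ.1, ‖x.1‖ < M → x ∈ s)
    (ω : γ.1 → ℕ → ℝ × Space d) :
    weightedField b t ψ χ γ ω
      = ∑ x ∈ s, χ x * ψ (x - displacement (totalRate b) t (ω x)) :=
  tsum_eq_sum fun x hx => by
    rw [hχ x.1 (not_lt.1 fun h => hx (hs x h)), zero_mul]

lemma measurable_weightedField (hψ : Continuous ψ) {χ : Space d → ℝ} {M : ℕ}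
    (hχ : ∀ x, (M : ℝ) ≤ ‖x‖ → χ x = 0) (γ : Config d) :
    Measurable (weightedField b t ψ χ γ) := by
  obtain ⟨s, hs⟩ := exists_finset_forall_norm_lt_mem γ M
  rw [show weightedField b t ψ χ γ = _ from funext fun ω => weightedField_eq_sum b t hχ hs ω]
  have hD := measurable_displacement (d := d) (totalRate b) t
  exact Finset.measurable_fun_sum _ fun x _ => measurable_const.mul
    (hψ.measurable.comp (measurable_const.sub (hD.comp (measurable_pi_apply x))))

/-- The weight depends on the starting point, not on the position at time `t`. Hence only the
finitely many particles starting in a ball contribute, and their independence gives a finite product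
of means. -/
lemma lintegral_exp_weightedField (hψ : Continuous ψ) (hB : ∀ x, |ψ x| ≤ B) {χ : Space d → ℝ}
    {M : ℕ} (hχ : ∀ x, (M : ℝ) ≤ ‖x‖ → χ x = 0) (γ : Config d) :
    ∫⁻ ω, ENNReal.ofReal (Real.exp (weightedField b t ψ χ γ ω)) ∂kawasakiLaw b γ
      = ENNReal.ofReal (Real.exp
          (pairing (fun x => Real.log (expMean (displacementLaw b t) ψ (χ x) x)) γ)) := by
  obtain ⟨s, hs⟩ := exists_finset_forall_norm_lt_mem γ M
  have hD := measurable_displacement (d := d) (totalRate b) t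
  simp_rw [weightedField_eq_sum b t hχ hs]
  rw [pairing, tsum_eq_sum (s := s) fun x hx => by
    rw [hχ x.1 (not_lt.1 fun h => hx (hs x h)), expMean_zero, Real.log_one]]
  simp_rw [Real.exp_sum, Real.exp_log (expMean_pos (displacementLaw b t) hψ hB _ _),
    ENNReal.ofReal_prod_of_nonneg fun _ _ => (Real.exp_pos _).le]
  rw [ENNReal.ofReal_prod_of_nonneg fun _ _ => (expMean_pos (displacementLaw b t) hψ hB _ _).le]
  have hm : ∀ x : γ.1, Measurable fun w : ℕ → ℝ × Space d => ENNReal.ofReal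
      (Real.exp (χ x * ψ (x - displacement (totalRate b) t w))) := fun x => by fun_prop
  have hI := iIndepFun_infinitePi (P := fun _ : γ.1 => particleLaw b)
    (X := fun (x : γ.1) w => ENNReal.ofReal
      (Real.exp (χ x * ψ (x - displacement (totalRate b) t w)))) hm
  rw [kawasakiLaw, lintegral_prod_eq_prod_lintegral_of_indepFun s _ hI
    fun x => (hm x).comp (measurable_pi_apply x)]
  refine Finset.prod_congr rfl fun x _ => ?_
  rw [expMean, ofReal_integral_eq_lintegral_ofReal
    (integrable_exp_displaced _ hψ hB _ _) (Eventually.of_forall fun s => (Real.exp_pos _).le),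
    displacementLaw, lintegral_map (by fun_prop) hD]
  have h := lintegral_map (μ := Measure.infinitePi fun _ : γ.1 => particleLaw b) (hm x)
    (measurable_pi_apply x)
  rw [Measure.infinitePi_map_eval] at h
  exact h.symm

/-- The exponential moment of the field of `|ψ|`, weighted by the `n`-th cutoff. -/
noncomputable def cutoffMoment (μ : Measure (Space d)) (ψ : Space d → ℝ) (n : ℕ) (γ : Config d) :
    ℝ≥0∞ :=
  ENNReal.ofReal (Real.exp (pairing (fun x => Real.log (expMean μ ψ (cutoff n x) x)) γ))

lemma weightedField_cutoff_mono (hψ0 : ∀ x, 0 ≤ ψ x) (γ : Config d)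
    (ω : γ.1 → ℕ → ℝ × Space d) :
    Monotone fun n => weightedField b t ψ (cutoff n) γ ω := by
  intro m n hmn
  obtain ⟨s, hs⟩ := exists_finset_forall_norm_lt_mem γ n
  have hmn' : (m : ℝ) ≤ n := by exact_mod_cast hmn
  simp only
  rw [weightedField_eq_sum b t (fun x hx => cutoff_eq_zero hx) hs,
    weightedField_eq_sum b t (fun x hx => cutoff_eq_zero (hmn'.trans hx)) hs]
  exact Finset.sum_le_sum fun x _ => mul_le_mul_of_nonneg_right (cutoff_mono hmn _) (hψ0 _)

/-- The truncated moments of `|ψ|` increase, so by monotone convergence `hfin` makes their supremum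
an integrable majorant. Its almost sure finiteness also gives absolute summability of the field, so
the `tsum` is a genuine sum rather than the default value. -/
lemma tendsto_cutoffMoment (hψ : Continuous ψ) (hB : ∀ x, |ψ x| ≤ B) (γ : Config d)
    (hfin : ⨆ n, cutoffMoment (displacementLaw b t) (fun y => |ψ y|) n γ < ∞) :
    Tendsto (fun n => cutoffMoment (displacementLaw b t) ψ n γ) atTop
      (𝓝 (∫⁻ ω, ENNReal.ofReal (Real.exp (weightedField b t ψ (fun _ => 1) γ ω))
        ∂kawasakiLaw b γ)) := by
  have hψa : Continuous fun y => |ψ y| := by fun_prop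
  have hBa : ∀ x, |(|ψ x|)| ≤ B := fun x => (abs_abs _).trans_le (hB x)
  have hcz : ∀ (n : ℕ) (x : Space d), (n : ℝ) ≤ ‖x‖ → cutoff n x = 0 :=
    fun n x hx => cutoff_eq_zero hx
  have hma := fun n => measurable_weightedField b t hψa (hcz n) γ
  have hm := fun n => measurable_weightedField b t hψ (hcz n) γ
  set G : ℕ → (γ.1 → ℕ → ℝ × Space d) → ℝ≥0∞ := fun n ω =>
    ENNReal.ofReal (Real.exp (weightedField b t (fun y => |ψ y|) (cutoff n) γ ω)) with hG
  have hGm : ∀ n, Measurable (G n) := fun n => (hma n).exp.ennreal_ofReal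
  have hGmono : Monotone G := fun m n hmn ω => ENNReal.ofReal_le_ofReal (Real.exp_le_exp.2
    (weightedField_cutoff_mono b t (fun _ => abs_nonneg _) γ ω hmn))
  have hGint : ∫⁻ ω, ⨆ n, G n ω ∂kawasakiLaw b γ < ∞ := by
    rw [lintegral_iSup hGm hGmono]
    simpa only [hG, lintegral_exp_weightedField b t hψa hBa (hcz _), cutoffMoment] using hfin
  simp only [cutoffMoment, ← lintegral_exp_weightedField b t hψ hB (hcz _)]
  refine tendsto_lintegral_of_dominated_convergence (fun ω => ⨆ n, G n ω)
    (fun n => (hm n).exp.ennreal_ofReal) (fun n => Eventually.of_forall fun ω => ?_) hGint.ne ?_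
  · refine le_trans (ENNReal.ofReal_le_ofReal (Real.exp_le_exp.2 ?_)) (le_iSup (fun n => G n ω) n)
    obtain ⟨s, hs⟩ := exists_finset_forall_norm_lt_mem γ n
    rw [weightedField_eq_sum b t (hcz n) hs, weightedField_eq_sum b t (hcz n) hs]
    exact Finset.sum_le_sum fun x _ => mul_le_mul_of_nonneg_left (le_abs_self _) (cutoff_nonneg _ _)
  · filter_upwards [ae_lt_top (Measurable.iSup hGm) hGint.ne] with ω hω
    obtain ⟨C, hC⟩ : ∃ C : ℝ, ∀ n, weightedField b t (fun y => |ψ y|) (cutoff n) γ ω ≤ C := by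
      refine ⟨(⨆ n, G n ω).toReal, fun n => ?_⟩
      have h1 : G n ω ≤ ⨆ n, G n ω := le_iSup (fun n => G n ω) n
      have h2 := ENNReal.toReal_mono hω.ne h1
      rw [hG, ENNReal.toReal_ofReal (Real.exp_pos _).le] at h2
      linarith [Real.add_one_le_exp (weightedField b t (fun y => |ψ y|) (cutoff n) γ ω)]
    have hsum : Summable fun x : γ.1 => |ψ (x - displacement (totalRate b) t (ω x))| := by
      refine summable_of_sum_le (fun _ => abs_nonneg _) (c := C) fun u => ?_
      -- A cutoff equal to one on the finite set `u` bounds its partial sum by the weighted field,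
      -- hence by `C`.
      obtain ⟨n, hn⟩ : ∃ n, ∀ x ∈ u, cutoff n x.1 = 1 :=
        ((Filter.eventually_all_finset u).2 fun x _ => eventually_cutoff_eq_one x.1).exists
      obtain ⟨s, hs⟩ := exists_finset_forall_norm_lt_mem γ n
      classical
      have hs' : ∀ x : γ.1, ‖x.1‖ < n → x ∈ s ∪ u := fun x hx => Finset.mem_union_left _ (hs x hx)
      have h1 := hC n
      rw [weightedField_eq_sum b t (hcz n) hs'] at h1
      refine le_trans ?_ h1
      calc ∑ x ∈ u, |ψ (x - displacement (totalRate b) t (ω x))|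
          = ∑ x ∈ u, cutoff n x.1 * |ψ (x - displacement (totalRate b) t (ω x))| :=
            Finset.sum_congr rfl fun x hx => by rw [hn x hx, one_mul]
        _ ≤ _ := Finset.sum_le_sum_of_subset_of_nonneg Finset.subset_union_right
            fun x _ _ => mul_nonneg (cutoff_nonneg _ _) (abs_nonneg _)
    refine (ENNReal.continuous_ofReal.tendsto _).comp ((Real.continuous_exp.tendsto _).comp ?_)
    refine tendsto_tsum_of_dominated_convergence hsum
      (fun x => (tendsto_cutoff x.1).mul tendsto_const_nhds)
      (Eventually.of_forall fun n x => ?_)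
    rw [Real.norm_eq_abs, abs_mul, abs_of_nonneg (cutoff_nonneg _ _)]
    exact mul_le_of_le_one_left (abs_nonneg _) (cutoff_le_one _ _)

end Dynamics

/-! ### The Laplace transform of the empirical field -/

section Laplace

variable (b : Space d → ℝ) (t : ℝ) {z ψ : Space d → ℝ}

/-- Pass to the limit in the truncated identity on both sides. Integrability of the majorant over
the Poisson measure supplies, for almost every `γ`, the finiteness needed for the limit at fixed
`γ`. -/
theorem lintegral_exp_field [NeZero d] (hzm : Measurable z) (hz0 : ∀ x, 0 ≤ z x)
    (hz : ∃ C, ∀ x, z x ≤ C) (hψ : Continuous ψ) (hψs : HasCompactSupport ψ) :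
    ∫⁻ γ, ∫⁻ ω, ENNReal.ofReal (Real.exp (weightedField b t ψ (fun _ => 1) γ ω))
        ∂kawasakiLaw b γ ∂poissonConfig z
      = ENNReal.ofReal
          (Real.exp (∫ x, z x * (expMean (displacementLaw b t) ψ 1 x - 1))) := by
  set μ := displacementLaw b t
  obtain ⟨B, hB⟩ := hψ.bounded_above_of_compact_support hψs
  simp only [Real.norm_eq_abs] at hB
  obtain ⟨C, hC⟩ := hz
  have hψa : Continuous fun y => |ψ y| := by fun_prop
  have hBa : ∀ x, |(|ψ x|)| ≤ B := fun x => (abs_abs _).trans_le (hB x)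
  have hvan : ∀ (f : Space d → ℝ) (n : ℕ) (x : Space d), (n : ℝ) ≤ ‖x‖ →
      expMean μ f (cutoff n x) x = 1 := fun f n x hx => by rw [cutoff_eq_zero hx, expMean_zero]
  have hsupp : ∀ (f : Space d → ℝ) (n : ℕ),
      HasCompactSupport fun x => expMean μ f (cutoff n x) x - 1 := fun f n =>
    HasCompactSupport.intro (isCompact_closedBall 0 (n : ℝ)) fun x hx => by
      rw [hvan f n x (by simpa using (not_le.1 fun h => hx (by simpa using h)).le), sub_self]
  have hlogsupp : ∀ (f : Space d → ℝ) (n : ℕ),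
      HasCompactSupport fun x => Real.log (expMean μ f (cutoff n x) x) := fun f n =>
    HasCompactSupport.intro (isCompact_closedBall 0 (n : ℝ)) fun x hx => by
      rw [hvan f n x (by simpa using (not_le.1 fun h => hx (by simpa using h)).le), Real.log_one]
  have hcont : ∀ (f : Space d → ℝ), Continuous f → (∀ x, |f x| ≤ B) → ∀ n,
      Continuous fun x => expMean μ f (cutoff n x) x := fun f hf hfB n =>
    continuous_expMean μ hf hfB (continuous_cutoff n) (cutoff_nonneg n) (cutoff_le_one n)
  have hmeas : ∀ (f : Space d → ℝ), Continuous f → (∀ x, |f x| ≤ B) → ∀ n,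
      Measurable (cutoffMoment μ f n) := fun f hf hfB n =>
    (measurable_pairing ((hcont f hf hfB n).log fun x => (expMean_pos μ hf hfB _ x).ne')
      (hlogsupp f n)).exp.ennreal_ofReal
  have hint : ∀ (f : Space d → ℝ), Continuous f → (∀ x, |f x| ≤ B) → ∀ n,
      ∫⁻ γ, cutoffMoment μ f n γ ∂poissonConfig z
        = ENNReal.ofReal (Real.exp (∫ x, z x * (expMean μ f (cutoff n x) x - 1))) :=
    fun f hf hfB n => lintegral_exp_pairing_poissonConfig hzm hz0 ⟨C, hC⟩ (hcont f hf hfB n)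
      (fun x => expMean_pos μ hf hfB _ x) (hsupp f n)
  have hle : ∀ (f g : Space d → ℝ), Continuous f → (∀ x, |f x| ≤ B) → Continuous g →
      (∀ x, |g x| ≤ B) → ∀ m n, m ≤ n →
      (∀ (x : Space d) y, cutoff m x * f y ≤ cutoff n x * g y) →
      ∀ γ, cutoffMoment μ f m γ ≤ cutoffMoment μ g n γ := by
    intro f g hf hfB hg hgB m n hmn h γ
    have hmn' : (m : ℝ) ≤ n := by exact_mod_cast hmn
    refine ENNReal.ofReal_le_ofReal (Real.exp_le_exp.2 (pairing_mono γ (M := n) ?_ ?_ ?_))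
    · intro x hx; rw [hvan f m x (hmn'.trans hx), Real.log_one]
    · intro x hx; rw [hvan g n x hx, Real.log_one]
    · intro x
      exact Real.log_le_log (expMean_pos μ hf hfB _ x) (expMean_mono μ hf hfB hg hgB x (h x))
  have hW := integrable_expMean_sub_one μ hψ hψs hB
  have hzW : Integrable fun x => z x * (expMean μ (fun y => |ψ y|) 1 x - 1) :=
    hW.bdd_mul (c := C) hzm.aestronglyMeasurable (Eventually.of_forall fun x => by
      rw [Real.norm_of_nonneg (hz0 x)]; exact hC x)
  have hbd : ∀ (f : Space d → ℝ), Continuous f → (∀ x, |f x| = |ψ x|) → ∀ (n : ℕ) (x : Space d),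
      ‖z x * (expMean μ f (cutoff n x) x - 1)‖
        ≤ z x * (expMean μ (fun y => |ψ y|) 1 x - 1) := by
    intro f hf hfψ n x
    rw [norm_mul, Real.norm_of_nonneg (hz0 x)]
    refine mul_le_mul_of_nonneg_left ?_ (hz0 x)
    have := abs_expMean_sub_one_le μ hf (fun x => (hfψ x).trans_le (hB x)) (cutoff_nonneg n x)
      (cutoff_le_one n x) x
    simp only [hfψ] at this
    exact this
  have hsm : ∀ (f : Space d → ℝ), Continuous f → (∀ x, |f x| ≤ B) → ∀ n,
      AEStronglyMeasurable (fun x => z x * (expMean μ f (cutoff n x) x - 1)) volume :=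
    fun f hf hfB n => hzm.aestronglyMeasurable.mul
      ((hcont f hf hfB n).sub continuous_const).aestronglyMeasurable
  have hmono : Monotone fun n => cutoffMoment μ (fun y => |ψ y|) n := fun m n hmn =>
    hle _ _ hψa hBa hψa hBa m n hmn fun x y =>
      mul_le_mul_of_nonneg_right (cutoff_mono hmn x) (abs_nonneg _)
  have hfin : ∫⁻ γ, ⨆ n, cutoffMoment μ (fun y => |ψ y|) n γ ∂poissonConfig z < ∞ := by
    rw [lintegral_iSup (hmeas _ hψa hBa) hmono]
    refine lt_of_le_of_lt (iSup_le fun n => ?_) (ENNReal.ofReal_lt_top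
      (r := Real.exp (∫ x, z x * (expMean μ (fun y => |ψ y|) 1 x - 1))))
    rw [hint _ hψa hBa]
    refine ENNReal.ofReal_le_ofReal (Real.exp_le_exp.2 ?_)
    have hb := hbd _ hψa (fun x => abs_abs _) n
    exact integral_mono (hzW.mono' (hsm _ hψa hBa n) (Eventually.of_forall hb)) hzW
      fun x => (le_abs_self _).trans (hb x)
  have hlim1 : Tendsto (fun n => ∫⁻ γ, cutoffMoment μ ψ n γ ∂poissonConfig z) atTop
      (𝓝 (∫⁻ γ, ∫⁻ ω, ENNReal.ofReal (Real.exp (weightedField b t ψ (fun _ => 1) γ ω))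
        ∂kawasakiLaw b γ ∂poissonConfig z)) := by
    -- Only the truncated moments have to be measurable in `γ`; nothing is asked of their limit.
    refine tendsto_lintegral_of_dominated_convergence _ (hmeas _ hψ hB)
      (fun n => Eventually.of_forall fun γ => ?_) hfin.ne ?_
    · refine (hle _ _ hψ hB hψa hBa n n le_rfl (fun x y => ?_) γ).trans
        (le_iSup (fun n => cutoffMoment μ (fun y => |ψ y|) n γ) n)
      exact mul_le_mul_of_nonneg_left (le_abs_self _) (cutoff_nonneg _ _)
    · filter_upwards [ae_lt_top (Measurable.iSup (hmeas _ hψa hBa)) hfin.ne] with γ hγ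
      exact tendsto_cutoffMoment b t hψ hB γ hγ
  have hlim2 : Tendsto (fun n => ∫⁻ γ, cutoffMoment μ ψ n γ ∂poissonConfig z) atTop
      (𝓝 (ENNReal.ofReal (Real.exp (∫ x, z x * (expMean μ ψ 1 x - 1))))) := by
    simp_rw [hint _ hψ hB]
    refine (ENNReal.continuous_ofReal.tendsto _).comp ((Real.continuous_exp.tendsto _).comp ?_)
    refine tendsto_integral_of_dominated_convergence _ (hsm _ hψ hB) hzW
      (fun n => Eventually.of_forall (hbd _ hψ (fun _ => rfl) n))
      (Eventually.of_forall fun x => ?_)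
    refine tendsto_const_nhds.congr' ?_
    filter_upwards [eventually_cutoff_eq_one x] with n hn
    rw [hn]
  exact tendsto_nhds_unique hlim1 hlim2

lemma scaledLaplace_eq [NeZero d] (κ : ℕ) (hzm : Measurable z) (hz0 : ∀ x, 0 ≤ z x)
    (hz : ∃ C, ∀ x, z x ≤ C) {φ : Space d → ℝ} (hφ : Continuous φ) (hφs : HasCompactSupport φ)
    {ε : ℝ} (hε : 0 < ε) :
    scaledLaplace κ b z ε t φ = ENNReal.ofReal (Real.exp (∫ x, z (ε • x) *
      (expMean (displacementLaw b ((ε ^ κ)⁻¹ * t)) (fun x => ε ^ d * φ (ε • x)) 1 x - 1))) := by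
  have hs : HasCompactSupport fun x : Space d => ε ^ d * φ (ε • x) :=
    (hφs.comp_homeomorph (Homeomorph.smulOfNeZero ε hε.ne')).mul_left
  rw [← lintegral_exp_field (z := fun x => z (ε • x)) b _ (by fun_prop) (fun x => hz0 _)
    (hz.imp fun C hC x => hC _) (by fun_prop) hs]
  simp only [weightedField, one_mul]
  -- `jumpProcess` unfolds to the starting point minus `displacement`.
  rfl

end Laplace


/-! ### Characteristic functions of displacements -/

lemma charFun_displacementLaw {b : Space d → ℝ} (hb0 : ∀ x, 0 ≤ b x) (hb : Integrable b) {t : ℝ}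
    (ht : 0 ≤ t) (k : Space d) :
    charFun (displacementLaw b t) k
      = Complex.exp (t * ∫ u, (b u : ℂ) * (Complex.exp ((inner ℝ u k : ℝ) * Complex.I) - 1)) := by
  have hr : 0 ≤ totalRate b := integral_nonneg hb0
  have h0 : charFun (displacementLaw b t) k
      = Complex.exp (((totalRate b * t : ℝ) : ℂ) * (charFun (jumpLaw b) k - 1)) :=
    charFun_displacement (normalized (intensityMeasure b)) (totalRate b) t (mul_nonneg hr ht) k
  have hfin : IsFiniteMeasure (intensityMeasure b) := isFiniteMeasure_withDensity_ofReal hb.2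
  have hreal : (intensityMeasure b).real Set.univ = totalRate b := by
    rw [measureReal_def, intensityMeasure, withDensity_apply _ MeasurableSet.univ,
      setLIntegral_univ, ← ofReal_integral_eq_lintegral_ofReal hb (Eventually.of_forall hb0),
      ← totalRate, ENNReal.toReal_ofReal hr]
  have hI : Integrable (fun u : Space d => Complex.exp ((inner ℝ u k : ℝ) * Complex.I))
      (jumpLaw b) :=
    have : IsProbabilityMeasure (jumpLaw b) := isProbabilityMeasure_normalized _
    Integrable.of_bound (Continuous.aestronglyMeasurable (by fun_prop)) 1
      (Eventually.of_forall fun x => by rw [Complex.norm_exp_ofReal_mul_I])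
  have hcf : charFun (jumpLaw b) k - 1
      = ∫ u, (Complex.exp ((inner ℝ u k : ℝ) * Complex.I) - 1) ∂jumpLaw b := by
    have : IsProbabilityMeasure (jumpLaw b) := isProbabilityMeasure_normalized _
    rw [integral_sub hI (integrable_const _), charFun_apply]
    simp
  have hmul := mul_integral_normalized (intensityMeasure b)
    fun u => Complex.exp ((inner ℝ u k : ℝ) * Complex.I) - 1
  rw [hreal, intensityMeasure, integral_withDensity_eq_integral_toReal_smul₀
    hb.aestronglyMeasurable.aemeasurable.ennreal_ofReal (by simp), Complex.real_smul] at hmul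
  rw [h0, hcf]
  congr 1
  push_cast
  rw [mul_comm (totalRate b : ℂ), mul_assoc]
  congr 1
  refine hmul.trans (integral_congr_ae (Eventually.of_forall fun u => ?_))
  simp only [ENNReal.toReal_ofReal (hb0 u), Complex.real_smul]

/-! ### Moments of the jump kernel -/

section Moments

variable {a : Space d → ℝ}

/-- Since `a(-x) ≥ 0`, the kernel `a` is at most twice its even part. -/
lemma integrable_mul_mul_of_evenPart (ha0 : ∀ x, 0 ≤ a x) (ha : Integrable a)
    (hp : ∀ i j : Fin d, Integrable (fun x : Space d => x i * x j * evenPart a x)) (i j : Fin d) :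
    Integrable fun x : Space d => x i * x j * a x := by
  refine ((hp i j).const_mul 2).mono ?_ (Eventually.of_forall fun x => ?_)
  · exact (Continuous.aestronglyMeasurable (by fun_prop)).mul ha.aestronglyMeasurable
  · have h1 : a x ≤ 2 * evenPart a x := by rw [evenPart]; linarith [ha0 (-x)]
    have h2 : 0 ≤ evenPart a x := by linarith [ha0 x]
    rw [norm_mul (x i * x j) (a x), norm_mul (2 : ℝ), norm_mul (x i * x j) (evenPart a x), Real.norm_of_nonneg (ha0 x),
      Real.norm_of_nonneg h2, Real.norm_two]
    nlinarith [norm_nonneg (x i * x j)]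

lemma integrable_norm_sq_mul (hm : ∀ i j : Fin d, Integrable fun x : Space d => x i * x j * a x) :
    Integrable fun x : Space d => ‖x‖ ^ 2 * a x := by
  have h : ∀ x : Space d, ‖x‖ ^ 2 * a x = ∑ i, x i * x i * a x := fun x => by
    rw [EuclideanSpace.real_norm_sq_eq, Finset.sum_mul]
    exact Finset.sum_congr rfl fun i _ => by ring
  simp_rw [h]
  exact integrable_finsetSum _ fun i _ => hm i i

lemma integrable_smul_self (ha0 : ∀ x, 0 ≤ a x) (ha : Integrable a)
    (hm : ∀ i j : Fin d, Integrable fun x : Space d => x i * x j * a x) :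
    Integrable fun x : Space d => a x • x := by
  refine (ha.add (integrable_norm_sq_mul hm)).mono'
    (ha.aestronglyMeasurable.smul aestronglyMeasurable_id) (Eventually.of_forall fun x => ?_)
  rw [norm_smul, Real.norm_of_nonneg (ha0 x), Pi.add_apply]
  nlinarith [ha0 x, sq_nonneg (‖x‖ - 1), norm_nonneg x, mul_nonneg (ha0 x) (sq_nonneg (‖x‖ - 1)),
    mul_nonneg (ha0 x) (norm_nonneg x)]

lemma integral_mul_inner (ha0 : ∀ x, 0 ≤ a x) (ha : Integrable a)
    (hm : ∀ i j : Fin d, Integrable fun x : Space d => x i * x j * a x) (k : Space d) :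
    ∫ u, a u * inner ℝ u k = inner ℝ (firstMoment a) k := by
  rw [real_inner_comm, firstMoment, ← integral_inner (integrable_smul_self ha0 ha hm)]
  refine integral_congr_ae (Eventually.of_forall fun u => ?_)
  simp only
  rw [real_inner_smul_right, real_inner_comm]

lemma mul_inner_sq_eq_sum (u k : Space d) :
    a u * inner ℝ u k ^ 2 = ∑ i, ∑ j, k j * k i * (u i * u j * a u) := by
  have : inner ℝ u k = ∑ i, u i * k i := by
    rw [PiLp.inner_apply]; exact Finset.sum_congr rfl fun i _ => by simp [mul_comm]
  rw [this, sq, Finset.sum_mul_sum, Finset.mul_sum]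
  refine Finset.sum_congr rfl fun i _ => ?_
  rw [Finset.mul_sum]
  exact Finset.sum_congr rfl fun j _ => by ring

lemma integrable_mul_inner_sq
    (hm : ∀ i j : Fin d, Integrable fun x : Space d => x i * x j * a x) (k : Space d) :
    Integrable fun u : Space d => a u * inner ℝ u k ^ 2 := by
  simp_rw [mul_inner_sq_eq_sum]
  exact integrable_finsetSum _ fun i _ => integrable_finsetSum _ fun j _ => (hm i j).const_mul _

lemma integral_mul_inner_sq
    (hm : ∀ i j : Fin d, Integrable fun x : Space d => x i * x j * a x) (k : Space d) :
    ∫ u, a u * inner ℝ u k ^ 2 = ∑ i, ∑ j, secondMoment a i j * k j * k i := by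
  simp_rw [mul_inner_sq_eq_sum]
  rw [integral_finsetSum _ fun i _ => integrable_finsetSum _ fun j _ => (hm i j).const_mul _]
  refine Finset.sum_congr rfl fun i _ => ?_
  rw [integral_finsetSum _ fun j _ => (hm i j).const_mul _]
  refine Finset.sum_congr rfl fun j _ => ?_
  rw [integral_const_mul, secondMoment]
  ring

/-- The covariance matrix of the limiting diffusion at time `t`. -/
noncomputable def limitCovariance (a : Space d → ℝ) (t : ℝ) : Matrix (Fin d) (Fin d) ℝ :=
  Matrix.of fun i j => t * secondMoment a i j

lemma dotProduct_limitCovariance (t : ℝ) (k : Fin d → ℝ) :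
    k ⬝ᵥ (limitCovariance a t).mulVec k = t * ∑ i, ∑ j, secondMoment a i j * k j * k i := by
  simp only [dotProduct, Matrix.mulVec, limitCovariance, Matrix.of_apply, Finset.mul_sum]
  exact Finset.sum_congr rfl fun i _ => Finset.sum_congr rfl fun j _ => by ring

/-- The quadratic form is `t ∫ a(u) ⟨u,k⟩² du ≥ 0`. This is needed for the formula for the
characteristic function of `multivariateGaussian`. -/
lemma posSemidef_limitCovariance (ha0 : ∀ x, 0 ≤ a x)
    (hm : ∀ i j : Fin d, Integrable fun x : Space d => x i * x j * a x) {t : ℝ} (ht : 0 ≤ t) :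
    (limitCovariance a t).PosSemidef := by
  refine Matrix.PosSemidef.of_dotProduct_mulVec_nonneg ?_ fun k => ?_
  · ext i j
    simp only [Matrix.conjTranspose_apply, limitCovariance, Matrix.of_apply, star_trivial,
      secondMoment]
    congr 2
    ext x
    ring
  · have h := integral_mul_inner_sq hm (WithLp.toLp 2 k)
    rw [star_trivial, dotProduct_limitCovariance]
    refine mul_nonneg ht ?_
    simp only at h
    rw [← h]
    exact integral_nonneg fun u => mul_nonneg (ha0 u) (sq_nonneg _)

end Moments

/-! ### The diffusive scaling limit of the characteristic function -/

section Scaling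

variable {a : Space d → ℝ}

lemma weakKernel_nonneg (ha0 : ∀ x, 0 ≤ a x) {ε : ℝ} (h0 : 0 ≤ ε) (h1 : ε ≤ 1) (x : Space d) :
    0 ≤ weakKernel a ε x := by
  rw [weakKernel, evenPart, oddPart]
  nlinarith [ha0 x, ha0 (-x)]

lemma integrable_weakKernel (ha : Integrable a) (ε : ℝ) : Integrable (weakKernel a ε) :=
  ((ha.add ha.comp_neg).div_const 2).add (((ha.sub ha.comp_neg).div_const 2).const_mul ε)

/-- The kernel is `(1 + ε)/2 · a(u) + (1 - ε)/2 · a(-u)`. Reflecting the second term leaves the even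
function `cos - 1` with weight one and the odd function `sin` with weight `ε`. -/
lemma integral_weakKernel_mul (ha : Integrable a) (ε : ℝ) (k : Space d) :
    ∫ u, (weakKernel a ε u : ℂ) * (Complex.exp ((inner ℝ u k : ℝ) * Complex.I) - 1)
      = ∫ u, (a u : ℂ) * (((Real.cos (inner ℝ u k) - 1 : ℝ) : ℂ)
          + ((ε * Real.sin (inner ℝ u k) : ℝ) : ℂ) * Complex.I) := by
  set f : Space d → ℂ := fun u => Complex.exp ((inner ℝ u k : ℝ) * Complex.I) - 1 with hf
  have hfm : Continuous f := by fun_prop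
  have hfb : ∀ u, ‖f u‖ ≤ 2 := fun u => by
    refine (norm_sub_le _ _).trans ?_
    rw [Complex.norm_exp_ofReal_mul_I]; norm_num
  have hi1 : Integrable fun u => (a u : ℂ) * f u :=
    ha.ofReal.mul_bdd (c := 2) hfm.aestronglyMeasurable (Eventually.of_forall hfb)
  have hi2 : Integrable fun u => (a u : ℂ) * f (-u) :=
    ha.ofReal.mul_bdd (c := 2) (hfm.comp continuous_neg).aestronglyMeasurable
      (Eventually.of_forall fun u => hfb _)
  have hi3 : Integrable fun u => (a (-u) : ℂ) * f u := by
    have := hi2.comp_neg; simpa using this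
  have e1 : ∀ u, (weakKernel a ε u : ℂ) * f u
      = ((1 + ε) / 2 : ℂ) * ((a u : ℂ) * f u) + ((1 - ε) / 2 : ℂ) * ((a (-u) : ℂ) * f u) := by
    intro u; simp only [weakKernel, evenPart, oddPart]; push_cast; ring
  have e2 : ∫ u, (a (-u) : ℂ) * f u = ∫ u, (a u : ℂ) * f (-u) := by
    rw [← integral_neg_eq_self]; simp
  change ∫ u, (weakKernel a ε u : ℂ) * f u = _
  simp_rw [e1]
  rw [integral_add (hi1.const_mul _) (hi3.const_mul _), integral_const_mul, integral_const_mul, e2,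
    ← integral_const_mul, ← integral_const_mul, ← integral_add (hi1.const_mul _) (hi2.const_mul _)]
  refine integral_congr_ae (Eventually.of_forall fun u => ?_)
  simp only [hf, inner_neg_left, Complex.ofReal_neg, Complex.exp_mul_I, Complex.cos_neg,
    Complex.sin_neg]
  push_cast
  ring

lemma tendsto_sin_mul_div (θ : ℝ) :
    Tendsto (fun ε : ℝ => Real.sin (ε * θ) / ε) (𝓝[>] 0) (𝓝 θ) := by
  have h : HasDerivAt (fun ε : ℝ => Real.sin (ε * θ)) θ 0 := by
    have := ((hasDerivAt_id (0 : ℝ)).mul_const θ).sin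
    simpa using this
  have h2 := h.tendsto_slope_zero_right
  simpa [div_eq_inv_mul] using h2

lemma tendsto_cos_mul_sub_one_div (θ : ℝ) :
    Tendsto (fun ε : ℝ => (Real.cos (ε * θ) - 1) / ε ^ 2) (𝓝[>] 0) (𝓝 (-(θ ^ 2 / 2))) := by
  have h := ((tendsto_sin_mul_div (θ / 2)).pow 2).const_mul (-2)
  have e : -2 * (θ / 2) ^ 2 = -(θ ^ 2 / 2) := by ring
  rw [e] at h
  refine h.congr fun ε => ?_
  -- The half-angle formula reduces the second-order limit to the square of the first-order one.
  have : Real.cos (ε * θ) = 1 - 2 * Real.sin (ε * (θ / 2)) ^ 2 := by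
    have := Real.cos_sq' (ε * (θ / 2))
    rw [show ε * θ = 2 * (ε * (θ / 2)) by ring, Real.cos_two_mul, this]; ring
  rw [this]; ring

/-- With `θ = ⟨u,k⟩`, the integrand after division by `ε²` contains `(cos (εθ) - 1)/ε²` and `sin
(εθ)/ε`, bounded by `θ²` and `|θ|`. The second and first moments of `a` therefore dominate. -/
lemma tendsto_charExponent (ha0 : ∀ x, 0 ≤ a x) (ha : Integrable a)
    (hm : ∀ i j : Fin d, Integrable fun x : Space d => x i * x j * a x) (k : Space d) :
    Tendsto (fun ε : ℝ => ((((ε ^ 2)⁻¹ : ℝ) : ℂ)) *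
        ∫ u, (weakKernel a ε u : ℂ) * (Complex.exp ((inner ℝ u (ε • k) : ℝ) * Complex.I) - 1))
      (𝓝[>] 0)
      (𝓝 (((inner ℝ (firstMoment a) k : ℝ) : ℂ) * Complex.I
        - ((∑ i, ∑ j, secondMoment a i j * k j * k i : ℝ) : ℂ) / 2)) := by
  have hi1 : Integrable fun u : Space d => a u * inner ℝ u k := by
    refine ((integrable_smul_self ha0 ha hm).inner_const (𝕜 := ℝ) k).congr
      (Eventually.of_forall fun u => ?_)
    simp only
    rw [real_inner_smul_left]
  have hi2 := integrable_mul_inner_sq hm k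
  have hlim : Tendsto (fun ε : ℝ => ∫ u, (a u : ℂ) *
        (((((Real.cos (ε * inner ℝ u k) - 1) / ε ^ 2 : ℝ)) : ℂ)
          + ((Real.sin (ε * inner ℝ u k) / ε : ℝ) : ℂ) * Complex.I)) (𝓝[>] 0)
      (𝓝 (∫ u, (a u : ℂ) * (((-(inner ℝ u k ^ 2 / 2) : ℝ) : ℂ)
          + ((inner ℝ u k : ℝ) : ℂ) * Complex.I))) := by
    refine tendsto_integral_filter_of_dominated_convergence
      (fun u => |a u * inner ℝ u k ^ 2| + |a u * inner ℝ u k|) ?_ ?_ (hi2.abs.add hi1.abs) ?_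
    · refine Eventually.of_forall fun ε => ?_
      exact ha.ofReal.aestronglyMeasurable.mul
        (Continuous.aestronglyMeasurable (by fun_prop))
    · filter_upwards [self_mem_nhdsWithin] with ε hε
      have hε : 0 < ε := hε
      refine Eventually.of_forall fun u => ?_
      rw [norm_mul, Complex.norm_real, abs_mul, abs_mul, ← mul_add, ← Real.norm_eq_abs (a u)]
      refine mul_le_mul_of_nonneg_left ?_ (norm_nonneg _)
      refine (norm_add_le _ _).trans (add_le_add ?_ ?_)
      · rw [Complex.norm_real, Real.norm_eq_abs, abs_div, abs_of_pos (pow_pos hε 2),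
          div_le_iff₀ (pow_pos hε 2), abs_of_nonpos (by linarith [Real.cos_le_one (ε * inner ℝ u k)]),
          abs_of_nonneg (sq_nonneg _)]
        have := Real.one_sub_sq_div_two_le_cos (x := ε * inner ℝ u k)
        nlinarith [mul_nonneg (sq_nonneg ε) (sq_nonneg (inner ℝ u k : ℝ))]
      · rw [norm_mul, Complex.norm_I, mul_one, Complex.norm_real, Real.norm_eq_abs, abs_div,
          abs_of_pos hε, div_le_iff₀ hε]
        refine Real.abs_sin_le_abs.trans ?_
        rw [abs_mul, abs_of_pos hε, mul_comm]
    · refine Eventually.of_forall fun u => tendsto_const_nhds.mul (Tendsto.add ?_ (Tendsto.mul ?_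
        tendsto_const_nhds))
      · exact (Complex.continuous_ofReal.tendsto _).comp (tendsto_cos_mul_sub_one_div _)
      · exact (Complex.continuous_ofReal.tendsto _).comp (tendsto_sin_mul_div _)
  have hval : ∫ u, (a u : ℂ) * (((-(inner ℝ u k ^ 2 / 2) : ℝ) : ℂ)
          + ((inner ℝ u k : ℝ) : ℂ) * Complex.I)
      = ((inner ℝ (firstMoment a) k : ℝ) : ℂ) * Complex.I
        - ((∑ i, ∑ j, secondMoment a i j * k j * k i : ℝ) : ℂ) / 2 := by
    rw [← integral_mul_inner ha0 ha hm, ← integral_mul_inner_sq hm, ← integral_complex_ofReal,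
      ← integral_complex_ofReal, ← integral_mul_const, ← integral_div, ← integral_sub
      (hi1.ofReal.mul_const _) (hi2.ofReal.div_const _)]
    refine integral_congr_ae (Eventually.of_forall fun u => ?_)
    simp only
    push_cast
    ring
  rw [hval] at hlim
  refine hlim.congr' ?_
  filter_upwards [self_mem_nhdsWithin] with ε hε
  have hε : ε ≠ 0 := (show 0 < ε from hε).ne'
  rw [integral_weakKernel_mul ha, ← integral_const_mul]
  refine integral_congr_ae (Eventually.of_forall fun u => ?_)
  simp only [real_inner_smul_right]
  have hεc : (ε : ℂ) ≠ 0 := by exact_mod_cast hε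
  push_cast
  field_simp

/-- The law at time `t` of the displacement of the limiting diffusion. -/
noncomputable def limitLaw (a : Space d → ℝ) (t : ℝ) : Measure (Space d) :=
  multivariateGaussian (t • firstMoment a) (limitCovariance a t)

instance (t : ℝ) : IsProbabilityMeasure (limitLaw a t) := by
  unfold limitLaw; infer_instance

lemma charFun_limitLaw (ha0 : ∀ x, 0 ≤ a x)
    (hm : ∀ i j : Fin d, Integrable fun x : Space d => x i * x j * a x) {t : ℝ} (ht : 0 ≤ t)
    (k : Space d) :
    charFun (limitLaw a t) k
      = Complex.exp (t * (((inner ℝ (firstMoment a) k : ℝ) : ℂ) * Complex.I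
        - ((∑ i, ∑ j, secondMoment a i j * k j * k i : ℝ) : ℂ) / 2)) := by
  rw [limitLaw, charFun_multivariateGaussian (posSemidef_limitCovariance ha0 hm ht),
    dotProduct_limitCovariance, real_inner_smul_right, real_inner_comm]
  congr 1
  push_cast
  ring

/-- The law of the rescaled displacement of a particle at the diffusive time scale. -/
noncomputable def scaledDisplacementLaw (a : Space d → ℝ) (t ε : ℝ) : Measure (Space d) :=
  (displacementLaw (weakKernel a ε) ((ε ^ 2)⁻¹ * t)).map fun s => ε • s

instance (t ε : ℝ) : IsProbabilityMeasure (scaledDisplacementLaw a t ε) :=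
  Measure.isProbabilityMeasure_map (by fun_prop)

lemma tendsto_charFun_scaledDisplacementLaw (ha0 : ∀ x, 0 ≤ a x) (ha : Integrable a)
    (hm : ∀ i j : Fin d, Integrable fun x : Space d => x i * x j * a x) {t : ℝ} (ht : 0 ≤ t)
    (k : Space d) :
    Tendsto (fun ε => charFun (scaledDisplacementLaw a t ε) k) (𝓝[>] 0)
      (𝓝 (charFun (limitLaw a t) k)) := by
  rw [charFun_limitLaw ha0 hm ht]
  refine ((Complex.continuous_exp.tendsto _).comp
    ((tendsto_charExponent ha0 ha hm k).const_mul (t : ℂ))).congr' ?_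
  -- The bound `ε ≤ 1` keeps `weakKernel a ε` non-negative.
  filter_upwards [self_mem_nhdsWithin, Ioc_mem_nhdsGT one_pos] with ε hε hε1
  rw [scaledDisplacementLaw, charFun_map_smul, charFun_displacementLaw
    (weakKernel_nonneg ha0 hε1.1.le hε1.2) (integrable_weakKernel ha ε) (by positivity)]
  simp only [Function.comp_apply]
  congr 1
  push_cast
  ring

/-- Lévy's continuity theorem, applied along each sequence tending to zero from the right. -/
lemma tendsto_integral_scaledDisplacementLaw (ha0 : ∀ x, 0 ≤ a x) (ha : Integrable a)
    (hm : ∀ i j : Fin d, Integrable fun x : Space d => x i * x j * a x) {t : ℝ} (ht : 0 ≤ t)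
    {f : Space d → ℝ} (hf : Continuous f) {C : ℝ} (hC : ∀ x, |f x| ≤ C) :
    Tendsto (fun ε => ∫ s, f s ∂scaledDisplacementLaw a t ε) (𝓝[>] 0)
      (𝓝 (∫ s, f s ∂limitLaw a t)) := by
  refine tendsto_of_seq_tendsto fun u hu => ?_
  have h := ProbabilityMeasure.tendsto_of_tendsto_charFun
    (μ₀ := ⟨limitLaw a t, inferInstance⟩)
    (μ := fun n => ⟨scaledDisplacementLaw a t (u n), inferInstance⟩)
    fun k => (tendsto_charFun_scaledDisplacementLaw ha0 ha hm ht k).comp hu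
  exact ProbabilityMeasure.tendsto_iff_forall_integral_tendsto.1 h
    (BoundedContinuousFunction.ofNormedAddCommGroup f hf C hC)

end Scaling


/-! ### Smearing out the intensity -/

section Smear

variable {z : Space d → ℝ}

/-- The intensity tested against the translate of `g` by `s`. -/
noncomputable def smear (z g : Space d → ℝ) (s : Space d) : ℝ := ∫ y, z y * g (y - s)

lemma integrable_bounded_mul (hzm : Measurable z) {C : ℝ} (hC : ∀ x, |z x| ≤ C)
    {g : Space d → ℝ} (hg : Integrable g) : Integrable fun y => z y * g y :=
  hg.bdd_mul (c := C) hzm.aestronglyMeasurable (Eventually.of_forall hC)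

lemma abs_smear_le {C : ℝ} (hC : ∀ x, |z x| ≤ C) {g : Space d → ℝ}
    (hg : Integrable g) (s : Space d) : |smear z g s| ≤ C * ∫ y, |g y| := by
  have h1 : ∫ y, |g (y - s)| = ∫ y, |g y| := integral_sub_right_eq_self (fun y => |g y|) s
  rw [← h1, ← integral_const_mul]
  refine abs_integral_le_integral_abs.trans (integral_mono_of_nonneg
    (Eventually.of_forall fun _ => abs_nonneg _) ((hg.comp_sub_right s).abs.const_mul C)
    (Eventually.of_forall fun y => ?_))
  simp only [abs_mul]
  exact mul_le_mul_of_nonneg_right (hC y) (abs_nonneg _)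

lemma smear_sub (hzm : Measurable z) {C : ℝ} (hC : ∀ x, |z x| ≤ C) {g h : Space d → ℝ}
    (hg : Integrable g) (hh : Integrable h) (s : Space d) :
    smear z g s - smear z h s = smear z (fun y => g y - h y) s := by
  rw [smear, smear, ← integral_sub (integrable_bounded_mul hzm hC (hg.comp_sub_right s))
    (integrable_bounded_mul hzm hC (hh.comp_sub_right s))]
  simp only [smear, mul_sub]

/-- This is the convolution of the locally integrable `z` with the reflection of `g`. -/
lemma continuous_smear (hzm : Measurable z) {C : ℝ} (hC : ∀ x, |z x| ≤ C) {g : Space d → ℝ}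
    (hg : Continuous g) (hgs : HasCompactSupport g) : Continuous (smear z g) := by
  have hloc : LocallyIntegrable z := fun x =>
    ⟨Metric.ball x 1, Metric.ball_mem_nhds x one_pos,
      (Measure.integrableOn_of_bounded (M := C) measure_ball_lt_top.ne hzm.aestronglyMeasurable
        (Eventually.of_forall hC))⟩
  have h := HasCompactSupport.continuous_convolution_right (μ := volume)
    (ContinuousLinearMap.mul ℝ ℝ) (f := z) (g := fun y => g (-y))
    (hgs.comp_homeomorph (Homeomorph.neg _)) hloc (by fun_prop)
  convert h using 1
  ext s
  simp [smear, convolution]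

lemma integral_smear (hzm : Measurable z) {C : ℝ} (hC : ∀ x, |z x| ≤ C) {g : Space d → ℝ}
    (hg : Continuous g) (hgi : Integrable g) (μ : Measure (Space d)) [IsProbabilityMeasure μ] :
    ∫ s, smear z g s ∂μ = ∫ y, z y * ∫ s, g (y - s) ∂μ := by
  simp only [smear, ← integral_const_mul]
  refine (integral_integral_swap (f := fun y s => z y * g (y - s)) ?_).symm
  exact (integrable_prod_displaced μ hg hgi).bdd_mul (c := C)
    (hzm.comp measurable_fst).aestronglyMeasurable (Eventually.of_forall fun p => hC _)

end Smear

/-! ### Rewriting the exponent of the Laplace transform -/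

section Exponent

variable {z φ : Space d → ℝ}

/-- The function `ε^{-d} (e^{ε^d φ} - 1)`, which converges to `φ`. -/
noncomputable def expQuotient (φ : Space d → ℝ) (ε : ℝ) (y : Space d) : ℝ :=
  (ε ^ d)⁻¹ * (Real.exp (ε ^ d * φ y) - 1)

lemma continuous_expQuotient (hφ : Continuous φ) (ε : ℝ) : Continuous (expQuotient φ ε) := by
  unfold expQuotient; fun_prop

lemma integrable_expQuotient (hφ : Continuous φ) (hφs : HasCompactSupport φ) (ε : ℝ) :
    Integrable (expQuotient φ ε) :=
  (continuous_expQuotient hφ ε).integrable_of_hasCompactSupport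
    (HasCompactSupport.comp_left (g := fun y => (ε ^ d)⁻¹ * (Real.exp (ε ^ d * y) - 1)) hφs
      (by simp))

/-- The substitution `y = εx` produces `ε^{-d}`, which `expQuotient` absorbs, and turns `D` into
`εD`. Fubini then moves the displacement to the outside, where weak convergence can act on it. -/
lemma exponent_eq_integral_smear (a : Space d → ℝ) (hzm : Measurable z) {C : ℝ}
    (hC : ∀ x, |z x| ≤ C) (hφ : Continuous φ) (hφs : HasCompactSupport φ) (t : ℝ) {ε : ℝ}
    (hε : 0 < ε) :
    ∫ x, z (ε • x) * (expMean (displacementLaw (weakKernel a ε) ((ε ^ 2)⁻¹ * t))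
        (fun x => ε ^ d * φ (ε • x)) 1 x - 1)
      = ∫ s, smear z (expQuotient φ ε) s ∂scaledDisplacementLaw a t ε := by
  have hq := continuous_expQuotient hφ ε
  obtain ⟨B, hB⟩ := hφ.bounded_above_of_compact_support hφs
  set μ := displacementLaw (weakKernel a ε) ((ε ^ 2)⁻¹ * t)
  have hd : (0 : ℝ) < ε ^ d := pow_pos hε d
  rw [integral_smear hzm hC hq (integrable_expQuotient hφ hφs ε)]
  have h1 : ∀ y, ∫ s, expQuotient φ ε (y - s) ∂scaledDisplacementLaw a t ε
      = ∫ s, expQuotient φ ε (y - ε • s) ∂μ := fun y => by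
    rw [scaledDisplacementLaw, integral_map (by fun_prop)
      (Continuous.aestronglyMeasurable (by fun_prop))]
  simp_rw [h1]
  have h2 := Measure.integral_comp_smul (volume : Measure (Space d))
    (fun y => z y * ∫ s, expQuotient φ ε (y - ε • s) ∂μ) ε
  rw [finrank_euclideanSpace_fin, abs_of_pos (inv_pos.2 hd), smul_eq_mul,
    eq_inv_mul_iff_mul_eq₀ hd.ne', ← integral_const_mul] at h2
  rw [← h2]
  refine integral_congr_ae (Eventually.of_forall fun x => ?_)
  have hi := integrable_exp_displaced μ (ψ := fun x => ε ^ d * φ (ε • x)) (B := ε ^ d * B)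
    (by fun_prop) (fun x => by
      rw [abs_mul, abs_of_pos hd]; exact mul_le_mul_of_nonneg_left (hB _) hd.le) 1 x
  simp only [one_mul] at hi
  simp only [expMean, one_mul, expQuotient, integral_const_mul, ← smul_sub]
  rw [integral_sub hi (integrable_const _)]
  simp only [integral_const, probReal_univ, smul_eq_mul, mul_one]
  field_simp

/-- For `|h| ≤ 1` one has `|e^h - 1 - h| ≤ h²`. With `h = ε^d φ` the integrand is at most `ε^d φ²`,
and `ε^d → 0` because `d ≥ 1`. -/
lemma tendsto_integral_abs_expQuotient_sub [NeZero d] (hφ : Continuous φ)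
    (hφs : HasCompactSupport φ) :
    Tendsto (fun ε => ∫ y, |expQuotient φ ε y - φ y|) (𝓝[>] 0) (𝓝 0) := by
  obtain ⟨B, hB⟩ := hφ.bounded_above_of_compact_support hφs
  have hpow : Tendsto (fun ε : ℝ => ε ^ d) (𝓝[>] 0) (𝓝 0) := by
    have : Continuous fun ε : ℝ => ε ^ d := by fun_prop
    have h := this.tendsto 0
    rw [zero_pow (NeZero.ne d)] at h
    exact h.mono_left nhdsWithin_le_nhds
  have hsq : Integrable fun y => φ y ^ 2 := by
    refine Continuous.integrable_of_hasCompactSupport (by fun_prop) ?_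
    exact HasCompactSupport.comp_left (g := fun y : ℝ => y ^ 2) hφs (by simp)
  have hlim : Tendsto (fun ε : ℝ => ε ^ d * ∫ y, φ y ^ 2) (𝓝[>] 0) (𝓝 0) := by
    simpa using hpow.mul_const (∫ y, φ y ^ 2)
  have hsmall : ∀ᶠ ε : ℝ in 𝓝[>] 0, ε ^ d * B < 1 := by
    have := hpow.mul_const B
    rw [zero_mul] at this
    exact this.eventually (gt_mem_nhds one_pos)
  refine tendsto_of_tendsto_of_tendsto_of_le_of_le' tendsto_const_nhds hlim
    (Eventually.of_forall fun ε => integral_nonneg fun _ => abs_nonneg _) ?_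
  filter_upwards [hsmall, self_mem_nhdsWithin] with ε hε hε0
  have hd : (0 : ℝ) < ε ^ d := pow_pos hε0 d
  rw [← integral_const_mul]
  refine integral_mono_of_nonneg (Eventually.of_forall fun _ => abs_nonneg _) (hsq.const_mul _)
    (Eventually.of_forall fun y => ?_)
  have h1 : |ε ^ d * φ y| ≤ 1 := by
    rw [abs_mul, abs_of_pos hd]
    exact (mul_le_mul_of_nonneg_left (hB y) hd.le).trans hε.le
  have h2 := Real.abs_exp_sub_one_sub_id_le h1
  have h3 : expQuotient φ ε y - φ y
      = (ε ^ d)⁻¹ * (Real.exp (ε ^ d * φ y) - 1 - ε ^ d * φ y) := by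
    rw [expQuotient]; field_simp
  simp only
  rw [h3, abs_mul, abs_of_pos (inv_pos.2 hd), inv_mul_le_iff₀ hd]
  calc _ ≤ (ε ^ d * φ y) ^ 2 := h2
    _ = _ := by ring

end Exponent

/-! ### Fourier inversion -/

section Fourier

open FourierTransform

variable {φ : Space d → ℝ}

lemma fourier_eq (f : Space d → ℂ) (k : Space d) :
    fourier f k = (((2 * Real.pi) ^ (-(d : ℝ) / 2) : ℝ) : ℂ) * 𝓕 f ((2 * Real.pi)⁻¹ • k) := by
  rw [fourier, Real.fourier_eq']
  congr 1
  refine integral_congr_ae (Eventually.of_forall fun x => ?_)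
  simp only [real_inner_smul_right, smul_eq_mul]
  congr 2
  have : (Real.pi : ℂ) ≠ 0 := by exact_mod_cast Real.pi_ne_zero
  push_cast
  field_simp

lemma integrable_fourierIntegral (hφ : ContDiff ℝ (⊤ : ℕ∞) φ) (hφs : HasCompactSupport φ) :
    Continuous (fun y => (φ y : ℂ)) ∧ Integrable (fun y => (φ y : ℂ)) ∧
      Integrable (𝓕 fun y => (φ y : ℂ)) := by
  have h1 : ContDiff ℝ (⊤ : ℕ∞) fun y => (φ y : ℂ) := Complex.ofRealCLM.contDiff.comp hφ
  have h2 : HasCompactSupport fun y => (φ y : ℂ) := hφs.comp_left (g := fun y : ℝ => (y : ℂ)) rfl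
  let f : 𝓢(Space d, ℂ) := h2.toSchwartzMap h1
  have hf : (f : Space d → ℂ) = fun y => (φ y : ℂ) := rfl
  refine ⟨h1.continuous, hf ▸ f.integrable, ?_⟩
  have := (𝓕 f).integrable (μ := volume)
  rwa [SchwartzMap.fourier_coe, hf] at this

lemma integrable_fourier (hφ : ContDiff ℝ (⊤ : ℕ∞) φ) (hφs : HasCompactSupport φ) :
    Integrable (fourier fun y => (φ y : ℂ)) := by
  have h := (integrable_fourierIntegral hφ hφs).2.2
  have e : (fourier fun y => (φ y : ℂ)) = fun k =>
      (((2 * Real.pi) ^ (-(d : ℝ) / 2) : ℝ) : ℂ) *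
        𝓕 (fun y => (φ y : ℂ)) ((2 * Real.pi)⁻¹ • k) := funext fun k => fourier_eq _ k
  rw [e]
  exact (h.comp_smul (inv_ne_zero Real.two_pi_pos.ne')).const_mul _

lemma fourier_inversion (hφ : ContDiff ℝ (⊤ : ℕ∞) φ) (hφs : HasCompactSupport φ) (x : Space d) :
    (((2 * Real.pi) ^ (-(d : ℝ) / 2) : ℝ) : ℂ) *
      ∫ k, Complex.exp (Complex.I * ((inner ℝ k x : ℝ) : ℂ)) * fourier (fun y => (φ y : ℂ)) k
      = φ x := by
  obtain ⟨h1, h2, h3⟩ := integrable_fourierIntegral hφ hφs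
  set f : Space d → ℂ := fun y => (φ y : ℂ) with hf
  have hinv := congrFun (h1.fourierInv_fourier_eq h2 h3) x
  rw [Real.fourierInv_eq'] at hinv
  have hpi : (0 : ℝ) < 2 * Real.pi := Real.two_pi_pos
  have hs := Measure.integral_comp_smul (volume : Measure (Space d))
    (fun v => Complex.exp (((2 * Real.pi * inner ℝ v x : ℝ) : ℂ) * Complex.I) • 𝓕 f v)
    (2 * Real.pi)⁻¹
  rw [hinv, finrank_euclideanSpace_fin, inv_pow, inv_inv, abs_of_pos (pow_pos hpi d)] at hs
  have e : ∀ k, Complex.exp (Complex.I * ((inner ℝ k x : ℝ) : ℂ)) * fourier f k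
      = (((2 * Real.pi) ^ (-(d : ℝ) / 2) : ℝ) : ℂ) *
        (Complex.exp (((2 * Real.pi * inner ℝ ((2 * Real.pi)⁻¹ • k) x : ℝ) : ℂ) * Complex.I) •
          𝓕 f ((2 * Real.pi)⁻¹ • k)) := by
    intro k
    rw [fourier_eq, real_inner_smul_left, mul_inv_cancel_left₀ hpi.ne', smul_eq_mul,
      mul_comm Complex.I]
    ring
  simp_rw [e]
  rw [integral_const_mul, hs, Complex.real_smul, ← mul_assoc, ← mul_assoc, ← Complex.ofReal_mul,
    ← Complex.ofReal_mul, ← Real.rpow_natCast, ← Real.rpow_add hpi, ← Real.rpow_add hpi]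
  -- The two unitary normalizations cancel the Jacobian `(2π)^d` of the change of frequency
  -- variable.
  rw [show -(d : ℝ) / 2 + -(d : ℝ) / 2 + d = 0 by ring, Real.rpow_zero, Complex.ofReal_one, one_mul]

/-- The multiplier is the characteristic function of `μ` at `-k`. Writing it as an integral over `s`
and exchanging integrals leaves Fourier inversion at the point `x - s`. -/
lemma driftDiffusion_eq_integral (hφ : ContDiff ℝ (⊤ : ℕ∞) φ) (hφs : HasCompactSupport φ)
    (v : Space d) (σ : Fin d → Fin d → ℝ) (t : ℝ) (μ : Measure (Space d)) [IsProbabilityMeasure μ]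
    (hμ : ∀ k, charFun μ k = Complex.exp (t * (((inner ℝ v k : ℝ) : ℂ) * Complex.I
        - ((∑ i, ∑ j, σ i j * k j * k i : ℝ) : ℂ) / 2))) (x : Space d) :
    driftDiffusion v σ t φ x = ((∫ s, φ (x - s) ∂μ : ℝ) : ℂ) := by
  set f : Space d → ℂ := fun y => (φ y : ℂ) with hf
  have hfi := integrable_fourier hφ hφs
  have h1 : ∀ k, Complex.exp (Complex.I * ((inner ℝ k x : ℝ) : ℂ)) *
      Complex.exp (-(Complex.I * (t : ℂ) * ((inner ℝ v k : ℝ) : ℂ))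
        - (t : ℂ) / 2 * ((∑ i, ∑ j, σ i j * k j * k i : ℝ) : ℂ)) * fourier f k
      = ∫ s, Complex.exp (((inner ℝ k (x - s) : ℝ) : ℂ) * Complex.I) * fourier f k ∂μ := by
    intro k
    have hk := hμ (-k)
    -- Passing to `-k` flips the sign of the drift and leaves the quadratic form unchanged.
    have e2 : Complex.exp (-(Complex.I * (t : ℂ) * ((inner ℝ v k : ℝ) : ℂ))
        - (t : ℂ) / 2 * ((∑ i, ∑ j, σ i j * k j * k i : ℝ) : ℂ)) = charFun μ (-k) := by
      rw [hk]
      congr 1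
      simp only [inner_neg_right, PiLp.neg_apply, mul_neg, neg_mul, neg_neg]
      push_cast
      ring
    rw [e2, charFun_apply, integral_mul_const, ← integral_const_mul]
    congr 1
    refine integral_congr_ae (Eventually.of_forall fun s => ?_)
    simp only
    rw [← Complex.exp_add, inner_sub_right, inner_neg_right, real_inner_comm k s]
    congr 1
    push_cast
    ring
  rw [driftDiffusion]
  simp_rw [← hf, h1]
  rw [integral_integral_swap, ← integral_const_mul, ← integral_complex_ofReal]
  · refine integral_congr_ae (Eventually.of_forall fun s => ?_)
    simp only
    rw [← fourier_inversion hφ hφs (x - s)]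
    simp only [mul_comm Complex.I, hf]
  · have hfp : Integrable (fun p : Space d × Space d => fourier f p.1) (volume.prod μ) :=
      hfi.comp_fst μ
    refine hfp.bdd_mul (c := 1) (f := fun p : Space d × Space d =>
      Complex.exp (((inner ℝ p.1 (x - p.2) : ℝ) : ℂ) * Complex.I))
      (Continuous.aestronglyMeasurable (by fun_prop)) (Eventually.of_forall fun p => ?_)
    rw [Complex.norm_exp_ofReal_mul_I]

end Fourier

/-! ### Convergence of the Laplace transform -/

section Limit

variable {a z φ : Space d → ℝ}

/-- Both the measure and the integrand depend on `ε`. Replacing the integrand by `smear z φ` costs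
at most `C` times an `L¹` distance, uniformly over probability measures; what remains is weak
convergence tested on a bounded continuous function. -/
lemma tendsto_exponent [NeZero d] (ha0 : ∀ x, 0 ≤ a x) (ha : Integrable a)
    (hm : ∀ i j : Fin d, Integrable fun x : Space d => x i * x j * a x) {t : ℝ} (ht : 0 ≤ t)
    (hzm : Measurable z) {C : ℝ} (hC : ∀ x, |z x| ≤ C) (hφ : Continuous φ)
    (hφs : HasCompactSupport φ) :
    Tendsto (fun ε => ∫ s, smear z (expQuotient φ ε) s ∂scaledDisplacementLaw a t ε) (𝓝[>] 0)
      (𝓝 (∫ s, smear z φ s ∂limitLaw a t)) := by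
  have hφi : Integrable φ := hφ.integrable_of_hasCompactSupport hφs
  have hcφ := continuous_smear hzm hC hφ hφs
  have hbφ := abs_smear_le hC hφi
  have h1 := tendsto_integral_scaledDisplacementLaw ha0 ha hm ht hcφ hbφ
  have h2 : Tendsto (fun ε => ∫ s, smear z (expQuotient φ ε) s ∂scaledDisplacementLaw a t ε
      - ∫ s, smear z φ s ∂scaledDisplacementLaw a t ε) (𝓝[>] 0) (𝓝 0) := by
    have h3 := (tendsto_integral_abs_expQuotient_sub hφ hφs).const_mul C
    rw [mul_zero] at h3
    refine squeeze_zero_norm (fun ε => ?_) h3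
    have hqi := integrable_expQuotient hφ hφs ε
    have hqs : HasCompactSupport (expQuotient φ ε) :=
      HasCompactSupport.comp_left (g := fun y => (ε ^ d)⁻¹ * (Real.exp (ε ^ d * y) - 1)) hφs
        (by simp)
    have hcq := continuous_smear hzm hC (continuous_expQuotient hφ ε) hqs
    rw [← integral_sub
      (Integrable.of_bound hcq.aestronglyMeasurable _
        (Eventually.of_forall (abs_smear_le hC hqi)))
      (Integrable.of_bound hcφ.aestronglyMeasurable _ (Eventually.of_forall hbφ))]
    refine (norm_integral_le_of_norm_le_const (μ := scaledDisplacementLaw a t ε)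
      (C := C * ∫ y, |expQuotient φ ε y - φ y|) (Eventually.of_forall fun s => ?_)).trans ?_
    · rw [smear_sub hzm hC hqi hφi, Real.norm_eq_abs]
      exact abs_smear_le hC (hqi.sub hφi) s
    · simp
  simpa using h2.add h1

end Limit

end FreeKawasaki

/-! ### Convergence of the Laplace transforms -/

theorem mainTheorem6 {d : ℕ} (a z : FreeKawasaki.Space d → ℝ)
    (ha_nonneg : ∀ x, 0 ≤ a x) (ha_int : Integrable a volume)
    (hz_meas : Measurable z) (hz_nonneg : ∀ x, 0 ≤ z x) (hz_bdd : ∃ C : ℝ, ∀ x, z x ≤ C)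
    (hz_fourier : FreeKawasaki.FourierIsSignedMeasure z)
    (hq : FreeKawasaki.firstMoment (FreeKawasaki.oddPart a) ≠ 0)
    (hp : ∀ i j : Fin d, Integrable (fun x => x i * x j * FreeKawasaki.evenPart a x) volume)
    (t : ℝ) (ht : 0 ≤ t)
    (φ : FreeKawasaki.Space d → ℝ) (hφ : ContDiff ℝ (⊤ : ℕ∞) φ) (hφ_supp : HasCompactSupport φ) :
    (∀ᶠ ε in 𝓝[>] (0 : ℝ),
      FreeKawasaki.scaledLaplace 2 (FreeKawasaki.weakKernel a ε) z ε t φ < ⊤) ∧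
    Tendsto
      (fun ε : ℝ =>
        ((FreeKawasaki.scaledLaplace 2 (FreeKawasaki.weakKernel a ε) z ε t φ).toReal : ℂ))
      (𝓝[>] (0 : ℝ))
      (𝓝 (Complex.exp (∫ x, (z x : ℂ) *
        FreeKawasaki.driftDiffusion (FreeKawasaki.firstMoment a) (FreeKawasaki.secondMoment a)
          t φ x))) := by
  open FreeKawasaki in
  -- In dimension zero every vector vanishes, contrary to `hq`. Dimension at least one enters
  -- through the absence of atoms and through `ε^d → 0`.
  have hd : d ≠ 0 := by
    rintro rfl
    exact hq (Subsingleton.elim _ _)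
  have : NeZero d := ⟨hd⟩
  have hm := integrable_mul_mul_of_evenPart ha_nonneg ha_int hp
  have hφc := hφ.continuous
  have hφi : Integrable φ := hφc.integrable_of_hasCompactSupport hφ_supp
  obtain ⟨C, hC⟩ := hz_bdd
  have hC' : ∀ x, |z x| ≤ C := fun x => by rw [abs_of_nonneg (hz_nonneg x)]; exact hC x
  have hev : ∀ᶠ ε in 𝓝[>] (0 : ℝ), scaledLaplace 2 (weakKernel a ε) z ε t φ
      = ENNReal.ofReal (Real.exp
        (∫ s, smear z (expQuotient φ ε) s ∂scaledDisplacementLaw a t ε)) := by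
    filter_upwards [self_mem_nhdsWithin] with ε hε
    rw [scaledLaplace_eq _ t 2 hz_meas hz_nonneg ⟨C, hC⟩ hφc hφ_supp hε,
      exponent_eq_integral_smear a hz_meas hC' hφc hφ_supp t hε]
  refine ⟨hev.mono fun ε h => h ▸ ENNReal.ofReal_lt_top, ?_⟩
  have hlim := tendsto_exponent ha_nonneg ha_int hm ht hz_meas hC' hφc hφ_supp
  have hval : ∫ x, (z x : ℂ) * driftDiffusion (firstMoment a) (secondMoment a) t φ x
      = ((∫ s, smear z φ s ∂limitLaw a t : ℝ) : ℂ) := by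
    rw [integral_smear hz_meas hC' hφc hφi, ← integral_complex_ofReal]
    refine integral_congr_ae (Eventually.of_forall fun x => ?_)
    simp only [driftDiffusion_eq_integral hφ hφ_supp _ _ t (limitLaw a t)
      (charFun_limitLaw ha_nonneg hm ht), Complex.ofReal_mul]
  rw [hval, ← Complex.ofReal_exp]
  refine ((Complex.continuous_ofReal.tendsto _).comp
    ((Real.continuous_exp.tendsto _).comp hlim)).congr' ?_
  filter_upwards [hev] with ε hε
  rw [hε, ENNReal.toReal_ofReal (Real.exp_pos _).le]
  rfl
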